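/- Let $(A,\mathfrak m)$ be a Noetherian local ring, $M$ a finitely generated $A$-module and $s\ge 1$ an integer. A filtration of ideals in $A$ is a chain of ideals $A=(F)_0\supsetneq (F)_1\supseteq (F)_2\supseteq\cdots$ such that $(F)_m(F)_n\subseteq (F)_{m+n}$ for all $m,n\ge 0$. It is called good if there is an ideal $J$ of $A$ such that $J(F)_n\subseteq (F)_{n+1}$ for all $n\ge 0$ and $(F)_{n+1}=J(F)_n$ for all sufficiently large $n$, and $\mathfrak m$-primary if $(F)_1$ is an $\mathfrak m$-primary ideal. Let $F=\{(F)_n\}_{n\ge 0}$ be an $\mathfrak m$-primary good filtration and let $F_1,\dots,F_s$ be good filtrations in $A$ such that $I=(F_1)_1\cdots(F_s)_1$ is not contained in $\sqrt{\mathrm{Ann}\,M}$. Put $q=\dim M/(0_M:I^\infty)$, where $0_M:I^\infty=\{x\in M: I^kx=0\text{ for some }k\ge 0\}$. Then there are a nonzero polynomial $P\in\mathbb Q[X_0,X_1,\dots,X_s]$ of total degree exactly $q-1$ (so in particular $q\geq 1$) and an integer $N$ such that, for all integers $n_0,n_1,\dots,n_s\ge N$, the length on the left below is finite and $$\ell_A\!\left(\frac{(F)_{n_0}(F_1)_{n_1}\cdots(F_s)_{n_s}M}{(F)_{n_0+1}(F_1)_{n_1}\cdots(F_s)_{n_s}M}\right)=P(n_0,n_1,\dots,n_s).$$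 -/

import Mathlib

/-- A filtration of ideals `A = F₀ ⊋ F₁ ⊇ F₂ ⊇ ⋯` of a commutative ring `A`,
with `Fₘ Fₙ ⊆ Fₘ₊ₙ` for all `m, n`. -/
structure IdealFiltration (A : Type*) [CommRing A] where
  /-- The `n`-th ideal of the filtration. -/
  ideal : ℕ → Ideal A
  ideal_zero : ideal 0 = ⊤
  ideal_one_lt : ideal 1 < ideal 0
  ideal_succ_le : ∀ n, ideal (n + 1) ≤ ideal n
  mul_le : ∀ m n, ideal m * ideal n ≤ ideal (m + n)

namespace IdealFiltration

/-- `F` is an `I`-good filtration (equivalently, `I` is a reduction of `F`):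
`I Fₙ ⊆ Fₙ₊₁` for all `n`, with equality for all large `n`. -/
def IsGoodFor {A : Type*} [CommRing A] (F : IdealFiltration A) (I : Ideal A) : Prop :=
  (∀ n, I * F.ideal n ≤ F.ideal (n + 1)) ∧
    ∃ N, ∀ n, N ≤ n → F.ideal (n + 1) = I * F.ideal n

/-- `F` is a good filtration: it is `I`-good for some ideal `I`. -/
def IsGood {A : Type*} [CommRing A] (F : IdealFiltration A) : Prop :=
  ∃ I : Ideal A, F.IsGoodFor I

/-- A filtration of a local ring `(A, 𝔪)` is `𝔪`-primary if `F₁` is an `𝔪`-primary ideal. -/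
def IsMaximalPrimary {A : Type*} [CommRing A] [IsLocalRing A] (F : IdealFiltration A) : Prop :=
  (F.ideal 1).IsPrimary ∧ (F.ideal 1).radical = IsLocalRing.maximalIdeal A

end IdealFiltration

/-- The submodule `0_M : I^∞` of all `x ∈ M` with `Iⁿ x = 0` for some `n`. -/
def zeroColonPowers {A : Type*} [CommRing A] (I : Ideal A)
    (M : Type*) [AddCommGroup M] [Module A M] : Submodule A M where
  carrier := {x | ∃ n : ℕ, ∀ a ∈ I ^ n, a • x = 0}
  zero_mem' := ⟨0, fun a _ => smul_zero a⟩
  add_mem' := by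
    rintro x y ⟨m, hm⟩ ⟨n, hn⟩
    refine ⟨m + n, fun a ha => ?_⟩
    rw [smul_add, hm a (Ideal.pow_le_pow_right (Nat.le_add_right m n) ha),
      hn a (Ideal.pow_le_pow_right (Nat.le_add_left n m) ha), add_zero]
  smul_mem' := by
    rintro c x ⟨n, hn⟩
    refine ⟨n, fun a ha => ?_⟩
    rw [smul_comm, hn a ha, smul_zero]

/-- The submodule `(F)_{n₀} (F₁)_{n₁} ⋯ (F_s)_{n_s} M` of `M`. -/
def filtrationProduct {A : Type*} [CommRing A] (M : Type*) [AddCommGroup M] [Module A M]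
    {s : ℕ} (F : IdealFiltration A) (G : Fin s → IdealFiltration A)
    (n₀ : ℕ) (n : Fin s → ℕ) : Submodule A M :=
  (F.ideal n₀ * ∏ i, (G i).ideal (n i)) • (⊤ : Submodule A M)

/-- The Bhattacharya function: the length, possibly infinite, of the `A`-module
`(F)_{n₀} (F₁)_{n₁} ⋯ (F_s)_{n_s} M / (F)_{n₀+1} (F₁)_{n₁} ⋯ (F_s)_{n_s} M`. -/
noncomputable def bhattacharya {A : Type*} [CommRing A] (M : Type*) [AddCommGroup M] [Module A M]
    {s : ℕ} (F : IdealFiltration A) (G : Fin s → IdealFiltration A)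
    (n₀ : ℕ) (n : Fin s → ℕ) : ℕ∞ :=
  Module.length A
    (↥(filtrationProduct M F G n₀ n) ⧸
      (filtrationProduct M F G (n₀ + 1) n).submoduleOf (filtrationProduct M F G n₀ n))

/-! Write T for 0_M : I^∞. By Artin-Rees, I^m M meets T trivially for some m, so for large exponents
the length does not change when M is replaced by M/T. There no nonzero element is killed by a power
of I, nor by any product of the filtration ideals, since such a product contains a power of I.
Goodness gives ideals J_0, …, J_s with (F_i)_{n+a} = J_i^a (F_i)_n for n ≥ N. With L the product
module at (N, …, N), the length at N + m is therefore that of J^m L / J_0 J^m L. A multigraded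
Hilbert-Serre theorem makes it a polynomial P in m, nonzero by Nakayama.

Both degree bounds compare P with Hilbert-Samuel functions of the ideal J_0. Summing P in the
direction n_0 alone bounds the length of L/J_0^n L by O(n^{deg P + 1}). So q ≤ deg P + 1, because L
has the same annihilator as M/T.

For the converse the direction n_0 is not enough, as P may have smaller degree in it. Choose a ray c
with positive entries on which the leading form of P does not vanish, and put 𝔞 = ∏ J_i^{c_i} ⊆ J_0.
An Artin-Rees lemma uniform in the exponent of 𝔞 (`exists_uniform_artinRees`) bounds the sum over t
< T of the lengths of 𝔞^t L / J_0 𝔞^t L by the length of L / J_0^{kT+1} L, which is O(T^q). The sum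
itself grows at least like T^{deg P + 1}, so deg P + 1 ≤ q. -/

/-! ### Lengths of subquotients -/

section RelLength

variable {A : Type*} [CommRing A] {L L' : Type*} [AddCommGroup L] [Module A L]
  [AddCommGroup L'] [Module A L']

/-- The length of `U / (U ∩ V)` for two submodules `U`, `V` of a module. -/
noncomputable def relLength (U V : Submodule A L) : ℕ∞ :=
  Module.length A (↥U ⧸ V.submoduleOf U)

theorem mkQ_submoduleOf_eq_zero {U V : Submodule A L} {u : U} :
    (V.submoduleOf U).mkQ u = 0 ↔ (u : L) ∈ V := by
  rw [Submodule.mkQ_apply, Submodule.Quotient.mk_eq_zero]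
  rfl

theorem relLength_eq_length_of_surjective {U V : Submodule A L} (f : U →ₗ[A] L')
    (hf : Function.Surjective f) (hk : ∀ u : U, f u = 0 ↔ (u : L) ∈ V) :
    relLength U V = Module.length A L' := by
  have : V.submoduleOf U = LinearMap.ker f := by
    ext u
    simp [Submodule.submoduleOf, hk]
  rw [relLength, this]
  exact (f.quotKerEquivOfSurjective hf).length_eq

theorem relLength_top (V : Submodule A L) : relLength ⊤ V = Module.length A (L ⧸ V) := by
  refine relLength_eq_length_of_surjective (V.mkQ ∘ₗ Submodule.subtype ⊤) ?_ ?_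
  · intro y
    obtain ⟨x, rfl⟩ := V.mkQ_surjective y
    exact ⟨⟨x, trivial⟩, rfl⟩
  · simp

theorem relLength_add {U W V : Submodule A L} (hVW : V ≤ W) (hWU : W ≤ U) :
    relLength U V = relLength U W + relLength W V := by
  rw [add_comm]
  refine Module.length_eq_add_of_exact
    (Submodule.mapQ _ _ (Submodule.inclusion hWU) fun x hx => hx)
    (Submodule.mapQ _ _ LinearMap.id fun x hx => hVW hx) ?_ ?_ ?_
  · rw [← LinearMap.ker_eq_bot, LinearMap.ker_eq_bot']
    intro x
    obtain ⟨x, rfl⟩ := Submodule.mkQ_surjective _ x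
    intro hx
    exact mkQ_submoduleOf_eq_zero.2
      (mkQ_submoduleOf_eq_zero (u := Submodule.inclusion hWU x).1 hx)
  · intro x
    obtain ⟨x, rfl⟩ := Submodule.mkQ_surjective _ x
    exact ⟨Submodule.mkQ _ x, rfl⟩
  · intro x
    obtain ⟨x, rfl⟩ := Submodule.mkQ_surjective _ x
    constructor
    · intro hx
      have hx' : (x : L) ∈ W := mkQ_submoduleOf_eq_zero.1 hx
      exact ⟨Submodule.mkQ _ ⟨x, hx'⟩, rfl⟩
    · rintro ⟨y, hy⟩
      obtain ⟨y, rfl⟩ := Submodule.mkQ_surjective _ y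
      have : (x : L) - y ∈ V := by
        have := (Submodule.Quotient.eq _).1 hy.symm
        simpa [Submodule.submoduleOf] using this
      have hx' : (x : L) ∈ W := by
        have := W.add_mem (hVW this) y.2
        simpa using this
      exact mkQ_submoduleOf_eq_zero.2 hx'

theorem relLength_map (f : L →ₗ[A] L') (U : Submodule A L) (V : Submodule A L') :
    relLength (U.map f) V = relLength U (V.comap f) := by
  refine (relLength_eq_length_of_surjective
    ((V.submoduleOf (U.map f)).mkQ ∘ₗ f.submoduleMap U) ?_ ?_).symm
  · exact (Submodule.mkQ_surjective _).comp (f.submoduleMap_surjective U)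
  · intro u
    exact mkQ_submoduleOf_eq_zero

theorem relLength_inf (U V : Submodule A L) : relLength U (U ⊓ V) = relLength U V := by
  have : (U ⊓ V).submoduleOf U = V.submoduleOf U := by
    ext u
    simp [Submodule.submoduleOf]
  rw [relLength, relLength, this]

theorem relLength_sup (U V : Submodule A L) : relLength (U ⊔ V) V = relLength U V := by
  symm
  refine relLength_eq_length_of_surjective
    ((V.submoduleOf (U ⊔ V)).mkQ ∘ₗ Submodule.inclusion le_sup_left) ?_ ?_
  · intro x
    obtain ⟨⟨x, hx⟩, rfl⟩ := Submodule.mkQ_surjective _ x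
    obtain ⟨u, hu, v, hv, rfl⟩ := Submodule.mem_sup.1 hx
    refine ⟨⟨u, hu⟩, ?_⟩
    refine (Submodule.Quotient.eq _).2 ?_
    simpa [Submodule.submoduleOf] using hv
  · intro u
    exact mkQ_submoduleOf_eq_zero

theorem relLength_eq_zero_iff {U V : Submodule A L} : relLength U V = 0 ↔ U ≤ V := by
  rw [relLength, Module.length_eq_zero_iff, Submodule.Quotient.subsingleton_iff,
    Submodule.submoduleOf_eq_top]

theorem relLength_anti_right (U : Submodule A L) {V V' : Submodule A L} (h : V ≤ V') :
    relLength U V' ≤ relLength U V := by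
  rw [← relLength_inf U V, ← relLength_inf U V',
    relLength_add (inf_le_inf_left U h) inf_le_left]
  exact le_self_add

theorem relLength_mono_left {U U' : Submodule A L} (V : Submodule A L) (h : U ≤ U') :
    relLength U V ≤ relLength U' V := by
  rw [← relLength_sup U V, ← relLength_sup U' V,
    relLength_add le_sup_right (sup_le_sup_right h V)]
  exact le_add_self

/-- The lengths of the successive quotients of a descending chain add up. -/
theorem sum_relLength_of_antitone {W : ℕ → Submodule A L} (hW : Antitone W) (n : ℕ) :
    ∑ i ∈ Finset.range n, relLength (W i) (W (i + 1)) = relLength (W 0) (W n) := by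
  induction n with
  | zero => simp [relLength_eq_zero_iff.2 le_rfl]
  | succ n ih =>
    rw [Finset.sum_range_succ, ih, relLength_add (hW (Nat.le_succ n)) (hW (Nat.zero_le n))]

end RelLength

/-! ### Multigraded families, Rees algebras and uniform Artin-Rees -/

section StableFamily

variable {A : Type*} [CommRing A] {L : Type*} [AddCommGroup L] [Module A L]
  {ι σ : Type*} [DecidableEq ι]

/-- A family of submodules of `L` indexed by multidegrees is stable under the operators indexed
by `s` if multiplication by `x j` maps degree `n` to degree `n + e_{c j}` for every `j ∈ s`. -/
def IsStableFamily (x : σ → A) (c : σ → ι) (s : Set σ) (W : (ι → ℕ) → Submodule A L) : Prop :=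
  ∀ j ∈ s, ∀ n, ∀ w ∈ W n, x j • w ∈ W (n + Pi.single (c j) 1)

/-- The stable families between two given families of submodules. -/
def stableFamilies (x : σ → A) (c : σ → ι) (s : Set σ) (V U : (ι → ℕ) → Submodule A L) :
    Set ((ι → ℕ) → Submodule A L) :=
  {W | IsStableFamily x c s W ∧ V ≤ W ∧ W ≤ U}

/-- The ideal generated by the operators of degree `e_i`. -/
def operatorIdeal (x : σ → A) (c : σ → ι) (i : ι) : Ideal A :=
  Ideal.span (x '' (c ⁻¹' {i}))

omit [DecidableEq ι] in
theorem exists_operatorIdeal_eq [IsNoetherianRing A] [Finite ι] (J : ι → Ideal A) :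
    ∃ (k : ℕ) (x : Fin k → A) (c : Fin k → ι), ∀ i, operatorIdeal x c i = J i := by
  have hfg : ∀ i, ∃ s : Finset A, Ideal.span (s : Set A) = J i := fun i =>
    IsNoetherian.noetherian (J i)
  choose s hs using hfg
  obtain ⟨k, ⟨e⟩⟩ := Finite.exists_equiv_fin (Σ i, s i)
  refine ⟨k, fun j => (e.symm j).2, fun j => (e.symm j).1, fun i => ?_⟩
  rw [operatorIdeal, ← hs i]
  congr 1
  ext a
  constructor
  · rintro ⟨j, rfl, rfl⟩
    exact (e.symm j).2.2
  · intro ha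
    refine ⟨e ⟨i, a, ha⟩, by simp, ?_⟩
    change ((e.symm (e ⟨i, a, ha⟩)).2 : A) = a
    rw [e.symm_apply_apply]

variable [Fintype ι]

section Rees

open MvPolynomial

/-- The homomorphism from the polynomial ring onto the multi-Rees algebra. -/
noncomputable def reesMap (x : σ → A) (c : σ → ι) : MvPolynomial σ A →ₐ[A] MvPolynomial ι A :=
  aeval fun j => C (x j) * X (c j)

theorem monomial_mem_range_reesMap (x : σ → A) (c : σ → ι) (n : ι → ℕ) {a : A}
    (ha : a ∈ ∏ i, operatorIdeal x c i ^ n i) :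
    monomial (Finsupp.equivFunOnFinite.symm n) a ∈ (reesMap x c).range := by
  let r : (ι →₀ ℕ) → Ideal A := fun n =>
    { carrier := {a | monomial n a ∈ (reesMap x c).range}
      zero_mem' := by
        change monomial n 0 ∈ (reesMap x c).range
        rw [map_zero]
        exact zero_mem _
      add_mem' := by
        intro a b ha hb
        change monomial n (a + b) ∈ (reesMap x c).range
        rw [map_add]
        exact add_mem (S := Subalgebra A (MvPolynomial ι A)) ha hb
      smul_mem' := by
        intro a b hb
        change monomial n (a • b) ∈ (reesMap x c).range
        rw [← smul_monomial]
        exact (reesMap x c).range.smul_mem hb a }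
  have hone : (1 : Ideal A) ≤ r 0 := by
    intro a _
    exact (reesMap x c).range.algebraMap_mem a
  have hmul : ∀ m n, r m * r n ≤ r (m + n) := by
    intro m n
    rw [Ideal.mul_le]
    intro a ha b hb
    change monomial (m + n) (a * b) ∈ (reesMap x c).range
    rw [← monomial_mul]
    exact mul_mem (S := Subalgebra A (MvPolynomial ι A)) ha hb
  have hgen : ∀ i, operatorIdeal x c i ≤ r (Finsupp.single i 1) := by
    intro i
    rw [operatorIdeal, Ideal.span_le]
    rintro _ ⟨j, rfl, rfl⟩
    refine ⟨X j, ?_⟩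
    simp only [AlgHom.toRingHom_eq_coe, RingHom.coe_coe]
    rw [reesMap, aeval_X, C_mul_X_eq_monomial]
  have hpow : ∀ i (k : ℕ), operatorIdeal x c i ^ k ≤ r (Finsupp.single i k) := by
    intro i k
    induction k with
    | zero => simpa using hone
    | succ k ih =>
      rw [pow_succ, Finsupp.single_add]
      exact (Ideal.mul_mono ih (hgen i)).trans (hmul _ _)
  have hprod : ∀ s : Finset ι, ∏ i ∈ s, operatorIdeal x c i ^ n i ≤
      r (∑ i ∈ s, Finsupp.single i (n i)) := by
    classical
    intro s
    induction s using Finset.induction_on with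
    | empty => simpa using hone
    | insert i s hi ih =>
      rw [Finset.prod_insert hi, Finset.sum_insert hi]
      exact (Ideal.mul_mono (hpow i _) ih).trans (hmul _ _)
  have := hprod Finset.univ ha
  have hn : ∑ i, Finsupp.single i (n i) = Finsupp.equivFunOnFinite.symm n := by
    ext i
    simp [Finsupp.finsetSum_apply, Finsupp.single_apply]
  rwa [hn] at this

/-- The submodule of a free module over the polynomial ring which corresponds to a stable
family of submodules of a module generated by `m`. -/
noncomputable def familySubmodule {x : σ → A} {c : σ → ι} {W : (ι → ℕ) → Submodule A L} {g : ℕ}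
    (m : Fin g → L) (hW : IsStableFamily x c Set.univ W) :
    Submodule (MvPolynomial σ A) (Fin g → MvPolynomial σ A) where
  carrier := {f | ∀ n : ι → ℕ,
    ∑ i, coeff (Finsupp.equivFunOnFinite.symm n) (reesMap x c (f i)) • m i ∈ W n}
  zero_mem' := by
    intro n
    simp
  add_mem' := by
    intro f g hf hg n
    have := add_mem (hf n) (hg n)
    simpa [add_smul, Finset.sum_add_distrib] using this
  smul_mem' := by
    intro p
    induction p using MvPolynomial.induction_on with
    | C a =>
      intro f hf n
      have := (W n).smul_mem a (hf n)
      simpa [Finset.smul_sum, smul_smul, reesMap, algebraMap_eq, coeff_C_mul] using this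
    | add p q hp hq =>
      intro f hf n
      have := add_mem (hp hf n) (hq hf n)
      simpa [add_smul, add_mul, Finset.sum_add_distrib] using this
    | mul_X p j hp =>
      intro f hf
      rw [mul_smul]
      refine hp fun n => ?_
      -- Multiplication by `X j` shifts degrees by e_{c j}, so coefficients in degrees with zero
      -- entry at `c j` vanish.
      by_cases hn : n (c j) = 0
      · have : ∀ i, coeff (Finsupp.equivFunOnFinite.symm n)
            (reesMap x c (((X j : MvPolynomial σ A) • f) i)) = 0 := by
          intro i
          simp [reesMap, mul_assoc, coeff_C_mul, coeff_X_mul', hn]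
        simp only [this, zero_smul, Finset.sum_const_zero, zero_mem]
      · obtain ⟨n', rfl⟩ : ∃ n' : ι → ℕ, n = n' + Pi.single (c j) 1 := by
          refine ⟨n - Pi.single (c j) 1, ?_⟩
          funext i
          rw [Pi.add_apply, Pi.sub_apply, Nat.sub_add_cancel]
          by_cases hi : i = c j
          · subst hi
            simpa using Nat.one_le_iff_ne_zero.2 hn
          · simp [hi]
        have h := hW j trivial n' _ (hf n')
        have hs : Finsupp.equivFunOnFinite.symm (n' + Pi.single (c j) 1) =
            Finsupp.single (c j) 1 + Finsupp.equivFunOnFinite.symm n' := by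
          ext i
          simp [Finsupp.single_apply, Pi.single_apply, add_comm, eq_comm]
        rw [Finset.smul_sum] at h
        simpa [reesMap, mul_assoc, coeff_C_mul, hs, coeff_X_mul, smul_smul] using h

/-- Embeds the order of stable families into the submodules of a finite free module over a
Noetherian polynomial ring, whence the chain condition. The inclusion in J^n L allows every element
of degree n to be lifted to a vector of polynomials concentrated in degree n. -/
theorem familySubmodule_le_iff {x : σ → A} {c : σ → ι} {W W' : (ι → ℕ) → Submodule A L} {g : ℕ}
    {m : Fin g → L} (hm : Submodule.span A (Set.range m) = ⊤)
    (hW : IsStableFamily x c Set.univ W) (hW' : IsStableFamily x c Set.univ W')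
    (hWU : ∀ n, W n ≤ (∏ i, operatorIdeal x c i ^ n i) • (⊤ : Submodule A L)) :
    familySubmodule m hW ≤ familySubmodule m hW' ↔ W ≤ W' := by
  constructor
  · intro h n w hw
    have key : ∃ a : Fin g → A, (∀ i, monomial (Finsupp.equivFunOnFinite.symm n) (a i) ∈
        (reesMap x c).range) ∧ ∑ i, a i • m i = w := by
      refine Submodule.smul_induction_on (hWU n hw) ?_ ?_
      · intro r hr v _
        have hv : v ∈ Submodule.span A (Set.range m) := hm ▸ trivial
        obtain ⟨b, rfl⟩ := (Submodule.mem_span_range_iff_exists_fun A).1 hv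
        refine ⟨fun i => r * b i, fun i => ?_, ?_⟩
        · exact monomial_mem_range_reesMap x c n (Ideal.mul_mem_right _ _ hr)
        · simp [Finset.smul_sum, mul_smul]
      · rintro _ _ ⟨a, ha, rfl⟩ ⟨b, hb, rfl⟩
        refine ⟨a + b, fun i => ?_, ?_⟩
        · rw [Pi.add_apply, map_add]
          exact add_mem (ha i) (hb i)
        · simp [add_smul, Finset.sum_add_distrib]
    obtain ⟨a, ha, haw⟩ := key
    choose f hf using ha
    have hfW : f ∈ familySubmodule m hW := by
      intro n'
      by_cases hn : n' = n
      · subst hn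
        have : ∀ i, coeff (Finsupp.equivFunOnFinite.symm n') (reesMap x c (f i)) = a i := by
          intro i
          exact (congrArg _ (hf i)).trans (by simp)
        simp only [this, haw, hw]
      · have : ∀ i, coeff (Finsupp.equivFunOnFinite.symm n') (reesMap x c (f i)) = 0 := by
          intro i
          refine (congrArg _ (hf i)).trans ?_
          rw [coeff_monomial, if_neg]
          exact fun h => hn (Finsupp.equivFunOnFinite.symm.injective h).symm
        simp [this]
    have := h hfW n
    have hc : ∀ i, coeff (Finsupp.equivFunOnFinite.symm n) (reesMap x c (f i)) = a i := by
      intro i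
      exact (congrArg _ (hf i)).trans (by simp)
    simpa only [hc, haw] using this
  · intro h f hf n
    exact h n (hf n)

end Rees

/-- The ascending chain condition for stable families of submodules of `J^n L`. -/
theorem wellFoundedGT_stableFamilies [IsNoetherianRing A] [Module.Finite A L] [Finite σ]
    (x : σ → A) (c : σ → ι) (V U : (ι → ℕ) → Submodule A L)
    (hU : ∀ n, U n ≤ (∏ i, operatorIdeal x c i ^ n i) • (⊤ : Submodule A L)) :
    WellFoundedGT (stableFamilies x c Set.univ V U) := by
  obtain ⟨g, m, hm⟩ := Module.Finite.exists_fin (R := A) (M := L)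
  have hsm : StrictMono fun W : stableFamilies x c Set.univ V U =>
      familySubmodule m W.2.1 :=
    strictMono_of_le_iff_le fun W W' =>
      (familySubmodule_le_iff hm W.2.1 W'.2.1 fun n => (W.2.2.2 n).trans (hU n)).symm
  exact hsm.wellFoundedGT

/-- A form of the Artin-Rees lemma for the Rees module of `𝔞`, uniform in the exponent of `𝔞`. -/
theorem exists_uniform_artinRees (L : Type*) [AddCommGroup L] [Module A L]
    [IsNoetherianRing A] [Module.Finite A L] (J 𝔞 : Ideal A) :
    ∃ k, ∀ e n, (J ^ e * 𝔞 ^ n) • (⊤ : Submodule A L) ⊓ (𝔞 ^ (n + 1)) • ⊤ ≤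
      (J ^ (e - k) * 𝔞 ^ (n + 1)) • ⊤ := by
  obtain ⟨r, x, c, hJ⟩ := exists_operatorIdeal_eq ![J, 𝔞]
  have hwf := wellFoundedGT_stableFamilies x c (fun _ => (⊥ : Submodule A L))
    (fun n => (J ^ n 0 * 𝔞 ^ n 1) • ⊤) (fun n => by simp [hJ, Fin.prod_univ_two])
  have hx : ∀ j, x j ∈ (![J, 𝔞] : Fin 2 → Ideal A) (c j) := fun j =>
    hJ (c j) ▸ Ideal.subset_span ⟨j, rfl, rfl⟩
  -- Increasing in m because the truncated exponent n₀ - m decreases. The chain stabilises at some k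
  -- simultaneously in all degrees, which is the source of the uniformity.
  let W : ℕ →o stableFamilies x c Set.univ (fun _ => (⊥ : Submodule A L))
      (fun n => (J ^ n 0 * 𝔞 ^ n 1) • ⊤) :=
    { toFun := fun m => ⟨fun n => (J ^ n 0 * 𝔞 ^ n 1) • (⊤ : Submodule A L) ⊓
          (J ^ (n 0 - m) * 𝔞 ^ (n 1 + 1)) • ⊤, by
        refine ⟨?_, fun _ => bot_le, fun n => inf_le_left⟩
        intro j _ n w hw
        have hj := hx j
        generalize c j = i at hj
        have key : ∀ B B' B'' : Ideal A, B * B' ≤ B'' → x j ∈ B →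
            w ∈ B' • (⊤ : Submodule A L) → x j • w ∈ B'' • (⊤ : Submodule A L) := by
          intro B B' B'' h hB hw
          refine Submodule.smul_mono_left h ?_
          rw [Submodule.mul_smul]
          exact Submodule.smul_mem_smul hB hw
        fin_cases i
        · refine ⟨key J _ _ ?_ hj hw.1, key J _ _ ?_ hj hw.2⟩
          · rw [← mul_assoc, ← pow_succ']
            simp
          · rw [← mul_assoc, ← pow_succ']
            simp only [Fin.zero_eta, Fin.isValue, Pi.add_apply, Pi.single_eq_same, ne_eq,
              one_ne_zero, not_false_eq_true, Pi.single_eq_of_ne, add_zero]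
            exact Ideal.mul_mono_left (Ideal.pow_le_pow_right (by omega))
        · refine ⟨key 𝔞 _ _ ?_ hj hw.1, key 𝔞 _ _ ?_ hj hw.2⟩
          · rw [mul_left_comm, ← pow_succ']
            simp
          · rw [mul_left_comm, ← pow_succ']
            simp⟩
      monotone' := by
        intro m m' h n
        exact inf_le_inf_left _ (Submodule.smul_mono_left
          (Ideal.mul_mono_left (Ideal.pow_le_pow_right (by omega)))) }
  obtain ⟨k, hk⟩ := WellFoundedGT.monotone_chain_condition W
  refine ⟨k, fun e n => ?_⟩
  -- At stage `max e k` the exponent of J is truncated to 0, so the second factor is all of 𝔞^(n+1)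
  -- L.
  have h := congrFun (congrArg Subtype.val (hk (max e k) (le_max_right _ _))) ![e, n]
  have h' : (J ^ e * 𝔞 ^ n) • (⊤ : Submodule A L) ⊓ (J ^ (e - k) * 𝔞 ^ (n + 1)) • ⊤ =
      (J ^ e * 𝔞 ^ n) • (⊤ : Submodule A L) ⊓ (J ^ (e - max e k) * 𝔞 ^ (n + 1)) • ⊤ := h
  rw [Nat.sub_eq_zero_of_le (le_max_left e k), pow_zero, one_mul] at h'
  rw [← h']
  exact inf_le_right

end StableFamily

/-! ### Eventually polynomial functions of several variables -/

section EventuallyPolynomial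

/-- A function on `ℕ` which agrees with a polynomial for large arguments. -/
def IsEventuallyPolynomial (g : ℕ → ℚ) : Prop :=
  ∃ (p : Polynomial ℚ) (N : ℕ), ∀ n, N ≤ n → g n = p.eval (n : ℚ)

theorem exists_polynomial_eval_eq_sum_range (p : Polynomial ℚ) :
    ∃ q : Polynomial ℚ, ∀ n : ℕ, ∑ i ∈ Finset.range n, p.eval (i : ℚ) = q.eval (n : ℚ) := by
  induction p using Polynomial.induction_on' with
  | add p q hp hq =>
    obtain ⟨p', hp⟩ := hp
    obtain ⟨q', hq⟩ := hq
    exact ⟨p' + q', fun n => by simp [Finset.sum_add_distrib, hp, hq]⟩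
  | monomial k a =>
    refine ⟨Polynomial.C (a / (k + 1)) * (Polynomial.bernoulli k.succ -
      Polynomial.C (bernoulli k.succ)), fun n => ?_⟩
    have h := Polynomial.sum_range_pow_eq_bernoulli_sub n k
    have hk : (k + 1 : ℚ) ≠ 0 := by positivity
    simp only [Polynomial.eval_monomial, ← Finset.mul_sum, Polynomial.eval_mul,
      Polynomial.eval_C, Polynomial.eval_sub, ← h]
    field_simp

theorem IsEventuallyPolynomial.sum_range {g : ℕ → ℚ} (hg : IsEventuallyPolynomial g) :
    IsEventuallyPolynomial fun n => ∑ i ∈ Finset.range n, g i := by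
  obtain ⟨p, N, hp⟩ := hg
  obtain ⟨q, hq⟩ := exists_polynomial_eval_eq_sum_range p
  -- The constant absorbs the finitely many initial values where g differs from p.
  refine ⟨q + Polynomial.C (∑ i ∈ Finset.range N, (g i - p.eval (i : ℚ))), N, fun n hn => ?_⟩
  rw [Polynomial.eval_add, Polynomial.eval_C, ← hq, ← sub_eq_iff_eq_add',
    ← Finset.sum_sub_distrib]
  refine (Finset.sum_subset (Finset.range_mono hn) fun i _ hi => ?_).symm
  rw [hp i (by simpa using hi), sub_self]

variable {ι : Type*} [Fintype ι]

/-- The span of the products of eventually polynomial functions of the single variables. -/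
def eventuallyPolynomial (ι : Type*) [Fintype ι] : Submodule ℚ ((ι → ℕ) → ℚ) :=
  Submodule.span ℚ {f | ∃ g : ι → ℕ → ℚ, (∀ i, IsEventuallyPolynomial (g i)) ∧
    f = fun n => ∏ i, g i (n i)}

/-- This closure is the reason for working with spans of products: a function known to be polynomial
only when all arguments are large gives no control on sums starting at 0 in one coordinate. -/
theorem eventuallyPolynomial_sum_range [DecidableEq ι] (c : ι) {f : (ι → ℕ) → ℚ}
    (hf : f ∈ eventuallyPolynomial ι) :
    (fun n => ∑ i ∈ Finset.range (n c), f (Function.update n c i)) ∈ eventuallyPolynomial ι := by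
  induction hf using Submodule.span_induction with
  | mem f hf =>
    obtain ⟨g, hg, rfl⟩ := hf
    refine Submodule.subset_span
      ⟨Function.update g c fun n => ∑ i ∈ Finset.range n, g c i, fun i => ?_, ?_⟩
    · by_cases hi : i = c
      · subst hi
        simpa using (hg i).sum_range
      · simpa [hi] using hg i
    · funext n
      rw [← Finset.mul_prod_erase _ _ (Finset.mem_univ c)]
      simp only [Function.update_self]
      rw [Finset.sum_mul]
      refine Finset.sum_congr rfl fun k _ => ?_
      rw [← Finset.mul_prod_erase _ _ (Finset.mem_univ c)]
      simp only [Function.update_self]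
      congr 1
      refine Finset.prod_congr rfl fun i hi => ?_
      have hi : i ≠ c := Finset.ne_of_mem_erase hi
      simp [hi]
  | zero =>
    convert Submodule.zero_mem (eventuallyPolynomial ι) using 1
    funext n
    simp
  | add f g _ _ hf hg =>
    convert add_mem hf hg using 1
    funext n
    simp [Finset.sum_add_distrib]
  | smul a f _ hf =>
    convert Submodule.smul_mem _ a hf using 1
    funext n
    simp [Finset.mul_sum]

/-- The indicator of a point is a product of one-variable indicators, each eventually zero. -/
theorem mem_eventuallyPolynomial_of_finite {f : (ι → ℕ) → ℚ} {B : Set (ι → ℕ)} (hB : B.Finite)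
    (hf : ∀ n, n ∉ B → f n = 0) : f ∈ eventuallyPolynomial ι := by
  classical
  have : f = ∑ m ∈ hB.toFinset, f m • fun n : ι → ℕ => ∏ i, if n i = m i then (1 : ℚ) else 0 := by
    funext n
    have hprod : ∀ m : ι → ℕ, (∏ i, if n i = m i then (1 : ℚ) else 0) =
        if n = m then 1 else 0 := by
      intro m
      by_cases h : n = m
      · simp [h]
      · obtain ⟨i, hi⟩ := Function.ne_iff.1 h
        rw [if_neg h]
        exact Finset.prod_eq_zero (Finset.mem_univ i) (if_neg hi)
    simp only [Finset.sum_apply, Pi.smul_apply, hprod, smul_eq_mul, mul_ite, mul_one, mul_zero,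
      Finset.sum_ite_eq, Set.Finite.mem_toFinset]
    by_cases h : n ∈ B
    · simp [h]
    · simp [h, hf n h]
  rw [this]
  refine Submodule.sum_mem _ fun m _ => Submodule.smul_mem _ _ (Submodule.subset_span
    ⟨fun i k => if k = m i then 1 else 0, fun i => ⟨0, m i + 1, fun k hk => ?_⟩, rfl⟩)
  rw [Polynomial.eval_zero]
  exact if_neg (by omega)

theorem exists_mvPolynomial_of_mem_eventuallyPolynomial {f : (ι → ℕ) → ℚ}
    (hf : f ∈ eventuallyPolynomial ι) :
    ∃ (P : MvPolynomial ι ℚ) (N : ℕ), ∀ n : ι → ℕ, (∀ i, N ≤ n i) →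
      f n = MvPolynomial.eval (fun i => (n i : ℚ)) P := by
  induction hf using Submodule.span_induction with
  | mem f hf =>
    obtain ⟨g, hg, rfl⟩ := hf
    choose p N hp using hg
    refine ⟨∏ i, Polynomial.aeval (MvPolynomial.X i) (p i), ∑ i, N i, fun n hn => ?_⟩
    rw [map_prod]
    refine Finset.prod_congr rfl fun i _ => ?_
    rw [hp i _ ((Finset.single_le_sum (fun _ _ => Nat.zero_le _) (Finset.mem_univ i)).trans
      (hn i)), Polynomial.aeval_def, Polynomial.hom_eval₂]
    simp [Polynomial.eval₂_eq_eval_map]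
  | zero => exact ⟨0, 0, by simp⟩
  | add f g _ _ hf hg =>
    obtain ⟨P, N, hP⟩ := hf
    obtain ⟨Q, N', hQ⟩ := hg
    refine ⟨P + Q, max N N', fun n hn => ?_⟩
    rw [Pi.add_apply, map_add, hP n fun i => (le_max_left _ _).trans (hn i),
      hQ n fun i => (le_max_right _ _).trans (hn i)]
  | smul a f _ hf =>
    obtain ⟨P, N, hP⟩ := hf
    refine ⟨a • P, N, fun n hn => ?_⟩
    rw [Pi.smul_apply, hP n hn, MvPolynomial.smul_eval, smul_eq_mul]

end EventuallyPolynomial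

/-! ### Multigraded Hilbert-Serre theorem -/

section HilbertSerre

variable {A : Type*} [CommRing A] {L : Type*} [AddCommGroup L] [Module A L]
  {ι σ : Type*} [DecidableEq ι]

/-- Without operators every family between V and U is stable; switching from V to U in one more
degree at a time would give an infinite strictly ascending chain. -/
theorem finite_of_wellFoundedGT_stableFamilies_empty {x : σ → A} {c : σ → ι}
    {V U : (ι → ℕ) → Submodule A L} (hVU : V ≤ U)
    (hwf : WellFoundedGT (stableFamilies x c ∅ V U)) : {n | ¬ U n ≤ V n}.Finite := by
  classical
  by_contra hinf
  let e := Set.Infinite.natEmbedding _ hinf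
  let W : ℕ →o stableFamilies x c ∅ V U :=
    { toFun := fun m => ⟨fun n => if ∃ i < m, (e i : ι → ℕ) = n then U n else V n, by
        refine ⟨fun j hj => hj.elim, fun n => ?_, fun n => ?_⟩
        · dsimp only
          split_ifs
          exacts [hVU n, le_rfl]
        · dsimp only
          split_ifs
          exacts [le_rfl, hVU n]⟩
      monotone' := by
        intro m m' h n
        dsimp only
        split_ifs with h1 h2 h2
        · exact le_rfl
        · obtain ⟨i, hi, rfl⟩ := h1
          exact (h2 ⟨i, hi.trans_le h, rfl⟩).elim
        · exact hVU n
        · exact le_rfl }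
  obtain ⟨m, hm⟩ := WellFoundedGT.monotone_chain_condition W
  have h := congrFun (congrArg Subtype.val (hm (m + 1) (Nat.le_succ m))) (e m)
  have h' : (if ∃ i < m, (e i : ι → ℕ) = e m then U (e m) else V (e m)) =
      if ∃ i < m + 1, (e i : ι → ℕ) = e m then U (e m) else V (e m) := h
  rw [if_neg, if_pos ⟨m, Nat.lt_succ_self m, rfl⟩] at h'
  · exact (e m).2 h'.ge
  · rintro ⟨i, hi, h⟩
    exact hi.ne (e.injective (Subtype.ext h))

theorem sum_range_update_of_recurrence {h hK hC : (ι → ℕ) → ℚ} {c : ι}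
    (h0 : ∀ n : ι → ℕ, n c = 0 → h n = hC n)
    (hs : ∀ n : ι → ℕ, h (n + Pi.single c 1) = hC (n + Pi.single c 1) + (h n - hK n))
    (n : ι → ℕ) :
    h n = ∑ i ∈ Finset.range (n c), hC (Function.update n c i) + hC n -
      ∑ i ∈ Finset.range (n c), hK (Function.update n c i) := by
  have key : ∀ k, h (Function.update n c k) =
      ∑ i ∈ Finset.range k, hC (Function.update n c i) + hC (Function.update n c k) -
        ∑ i ∈ Finset.range k, hK (Function.update n c i) := by
    intro k
    induction k with
    | zero => simp [h0 (Function.update n c 0)]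
    | succ k ih =>
      have hu : Function.update n c (k + 1) = Function.update n c k + Pi.single c 1 := by
        funext i
        by_cases hi : i = c
        · subst hi
          simp
        · simp [hi]
      rw [Finset.sum_range_succ, Finset.sum_range_succ, hu, hs, ih]
      ring
  simpa using key (n c)

variable [Fintype ι]

/-- The **Hilbert-Serre theorem** for a multigraded subquotient satisfying the ascending chain
condition. -/
theorem relLength_mem_eventuallyPolynomial [DecidableEq σ] (x : σ → A) (c : σ → ι)
    (s : Finset σ) : ∀ V U : (ι → ℕ) → Submodule A L, V ≤ U → IsStableFamily x c s V →
      IsStableFamily x c s U → WellFoundedGT (stableFamilies x c s V U) →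
      (∀ n, relLength (U n) (V n) ≠ ⊤) →
      (fun n => ((relLength (U n) (V n)).toNat : ℚ)) ∈ eventuallyPolynomial ι := by
  induction s using Finset.induction_on with
  | empty =>
    intro V U hVU _ _ hwf _
    rw [Finset.coe_empty] at hwf
    refine mem_eventuallyPolynomial_of_finite
      (finite_of_wellFoundedGT_stableFamilies_empty hVU hwf) fun n hn => ?_
    rw [relLength_eq_zero_iff.2 (not_not.1 hn)]
    simp
  | insert j s hj ih =>
    intro V U hVU hV hU hwf hfin
    let μ : L →ₗ[A] L := LinearMap.lsmul A L (x j)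
    -- K/V and U/C are the kernel and cokernel of multiplication by `x j` on U/V. Both are killed by
    -- `x j`, so the chain condition for them needs only the operators in s.
    let K : (ι → ℕ) → Submodule A L := fun n => U n ⊓ (V (n + Pi.single (c j) 1)).comap μ
    -- The supremum is empty when n has zero entry at `c j`, giving C = V there and the initial
    -- value of the recurrence.
    let C : (ι → ℕ) → Submodule A L := fun n =>
      V n ⊔ ⨆ (n' : ι → ℕ) (_ : n' + Pi.single (c j) 1 = n), (U n').map μ
    have hjV : ∀ n, ∀ v ∈ V n, x j • v ∈ V (n + Pi.single (c j) 1) := hV j (by simp)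
    have hjU : ∀ n, ∀ v ∈ U n, x j • v ∈ U (n + Pi.single (c j) 1) := hU j (by simp)
    have hsV : IsStableFamily x c s V := fun i hi => hV i (by simp [hi])
    have hsU : IsStableFamily x c s U := fun i hi => hU i (by simp [hi])
    have hVK : V ≤ K := fun n => le_inf (hVU n) (hjV n)
    have hKU : K ≤ U := fun n => inf_le_left
    have hVC : V ≤ C := fun n => le_sup_left
    have hCU : C ≤ U := by
      refine fun n => sup_le (hVU n) (iSup₂_le ?_)
      rintro n' rfl
      exact Submodule.map_le_iff_le_comap.2 (hjU n')
    have hC_succ : ∀ n, C (n + Pi.single (c j) 1) =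
        (U n).map μ ⊔ V (n + Pi.single (c j) 1) := by
      intro n
      refine le_antisymm (sup_le le_sup_right (iSup₂_le fun n' hn' => ?_))
        (sup_le (le_sup_of_le_right (le_iSup₂_of_le n rfl le_rfl)) le_sup_left)
      rw [add_right_cancel hn']
      exact le_sup_left
    have hC_zero : ∀ n : ι → ℕ, n (c j) = 0 → C n = V n := by
      intro n hn
      refine le_antisymm (sup_le le_rfl (iSup₂_le ?_)) le_sup_left
      rintro n' rfl
      simp at hn
    have hsK : IsStableFamily x c s K := by
      intro i hi n u hu
      refine ⟨hsU i hi n u hu.1, ?_⟩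
      have := hsV i hi _ _ hu.2
      rw [add_right_comm] at this
      change x j • x i • u ∈ V (n + Pi.single (c i) 1 + Pi.single (c j) 1)
      rw [smul_comm]
      exact this
    have hsC : IsStableFamily x c s C := by
      intro i hi n u hu
      have : C n ≤ (C (n + Pi.single (c i) 1)).comap (LinearMap.lsmul A L (x i)) := by
        refine sup_le (fun v hv => hVC _ (hsV i hi n v hv)) (iSup₂_le ?_)
        rintro n' rfl
        rw [Submodule.map_le_iff_le_comap]
        intro u hu
        change x i • x j • u ∈ C (n' + Pi.single (c j) 1 + Pi.single (c i) 1)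
        rw [smul_comm, add_right_comm, hC_succ]
        exact Submodule.mem_sup_left ⟨_, hsU i hi n' u hu, rfl⟩
      exact this hu
    have hwfK : WellFoundedGT (stableFamilies x c s V K) := by
      let φ : stableFamilies x c s V K → stableFamilies x c (insert j s : Finset σ) V U :=
        fun W => ⟨W.1, by
          refine ⟨fun i hi => ?_, W.2.2.1, W.2.2.2.trans hKU⟩
          rcases Finset.mem_insert.1 hi with rfl | hi
          · exact fun n w hw => W.2.2.1 _ (W.2.2.2 n hw).2
          · exact W.2.1 i hi⟩
      have hφ : StrictMono φ := fun W W' h => h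
      exact hφ.wellFoundedGT
    have hwfC : WellFoundedGT (stableFamilies x c s C U) := by
      let φ : stableFamilies x c s C U → stableFamilies x c (insert j s : Finset σ) V U :=
        fun W => ⟨W.1, by
          refine ⟨fun i hi => ?_, hVC.trans W.2.2.1, W.2.2.2⟩
          rcases Finset.mem_insert.1 hi with rfl | hi
          · intro n w hw
            refine W.2.2.1 _ ?_
            rw [hC_succ]
            exact Submodule.mem_sup_left ⟨w, W.2.2.2 n hw, rfl⟩
          · exact W.2.1 i hi⟩
      have hφ : StrictMono φ := fun W W' h => h
      exact hφ.wellFoundedGT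
    have hadd : ∀ n, relLength (U n) (V n) = relLength (U n) (K n) + relLength (K n) (V n) :=
      fun n => relLength_add (hVK n) (hKU n)
    have hadd' : ∀ n, relLength (U (n + Pi.single (c j) 1)) (V (n + Pi.single (c j) 1)) =
        relLength (U (n + Pi.single (c j) 1)) (C (n + Pi.single (c j) 1)) +
          relLength (U n) (K n) := by
      intro n
      rw [relLength_add (hVC _) (hCU _)]
      congr 1
      rw [hC_succ, relLength_sup, relLength_map, ← relLength_inf]
    have hfinK : ∀ n, relLength (K n) (V n) ≠ ⊤ := fun n h => hfin n (by rw [hadd, h, add_top])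
    have hfinUK : ∀ n, relLength (U n) (K n) ≠ ⊤ := fun n h => hfin n (by rw [hadd, h, top_add])
    have hfinC : ∀ n, relLength (U n) (C n) ≠ ⊤ := fun n =>
      ne_top_of_le_ne_top (hfin n) (relLength_anti_right _ (hVC n))
    have ihK := ih V K hVK hsV hsK hwfK hfinK
    have ihC := ih C U hCU hsC hsU hwfC hfinC
    have key := sum_range_update_of_recurrence (c := c j)
      (h := fun n => ((relLength (U n) (V n)).toNat : ℚ))
      (hK := fun n => ((relLength (K n) (V n)).toNat : ℚ))
      (hC := fun n => ((relLength (U n) (C n)).toNat : ℚ))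
      (fun n hn => by rw [hC_zero n hn])
      (fun n => by
        rw [hadd' n, hadd n, ENat.toNat_add (hfinC _) (hfinUK n),
          ENat.toNat_add (hfinUK n) (hfinK n)]
        push_cast
        ring)
    rw [funext key]
    exact sub_mem (add_mem (eventuallyPolynomial_sum_range (c j) ihC) ihC)
      (eventuallyPolynomial_sum_range (c j) ihK)

/-- The lengths of `J^n L / B J^n L` are given by a polynomial in the multidegree `n`. -/
theorem exists_mvPolynomial_relLength_pow [IsNoetherianRing A] [Module.Finite A L]
    (J : ι → Ideal A) (B : Ideal A)
    (hfin : ∀ n : ι → ℕ, relLength ((∏ i, J i ^ n i) • (⊤ : Submodule A L))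
      ((B * ∏ i, J i ^ n i) • ⊤) ≠ ⊤) :
    ∃ (P : MvPolynomial ι ℚ) (N : ℕ), ∀ n : ι → ℕ, (∀ i, N ≤ n i) →
      ((relLength ((∏ i, J i ^ n i) • (⊤ : Submodule A L))
        ((B * ∏ i, J i ^ n i) • ⊤)).toNat : ℚ) = MvPolynomial.eval (fun i => (n i : ℚ)) P := by
  obtain ⟨k, x, c, hJ⟩ := exists_operatorIdeal_eq J
  have hx : ∀ j, x j ∈ J (c j) := fun j => hJ (c j) ▸ Ideal.subset_span ⟨j, rfl, rfl⟩
  have hprod : ∀ (n : ι → ℕ) (i : ι),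
      J i * ∏ l, J l ^ n l = ∏ l, J l ^ (n + Pi.single i 1 : ι → ℕ) l := by
    intro n i
    simp only [Pi.add_apply, pow_add, Finset.prod_mul_distrib]
    rw [mul_comm]
    congr 1
    rw [Finset.prod_eq_single i (fun l _ hl => by simp [hl]) (by simp)]
    simp
  have hstable : ∀ B : Ideal A, IsStableFamily x c ((Finset.univ : Finset (Fin k)) : Set (Fin k))
      (fun n => (B * ∏ i, J i ^ n i) • (⊤ : Submodule A L)) := by
    intro B j _ n w hw
    dsimp only
    rw [← hprod n (c j), mul_left_comm, Submodule.mul_smul]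
    exact Submodule.smul_mem_smul (hx j) hw
  refine exists_mvPolynomial_of_mem_eventuallyPolynomial
    (relLength_mem_eventuallyPolynomial x c Finset.univ
      (fun n => (B * ∏ i, J i ^ n i) • ⊤) (fun n => (∏ i, J i ^ n i) • ⊤)
      (fun n => Submodule.smul_mono_left Ideal.mul_le_right) (hstable B) ?_ ?_ hfin)
  · have h := hstable 1
    simp only [one_mul] at h
    exact h
  · rw [Finset.coe_univ]
    refine wellFoundedGT_stableFamilies x c _ _ fun n => ?_
    simp [hJ]

end HilbertSerre

/-! ### Dimension and growth of Hilbert-Samuel functions -/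

section HilbertSamuel

open IsLocalRing

variable {A : Type*} [CommRing A] {L : Type*} [AddCommGroup L] [Module A L]

theorem mkQ_mem_smul_top_iff (p B : Ideal A) (a : A) :
    p.mkQ a ∈ B • (⊤ : Submodule A (A ⧸ p)) ↔ a ∈ p ⊔ B := by
  have h : B • (⊤ : Submodule A (A ⧸ p)) = Submodule.map p.mkQ (B : Submodule A A) := by
    rw [← Submodule.range_mkQ p, ← Submodule.map_top, ← Submodule.map_smul'', smul_eq_mul,
      Ideal.mul_top]
  rw [h, ← Submodule.mem_comap, Submodule.comap_map_mkQ]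

theorem exists_artinRees_cyclic [IsNoetherianRing A] [Module.Finite A L] (J : Ideal A) (v : L) :
    ∃ k, ∀ (n : ℕ) (a : A), a • v ∈ J ^ n • (⊤ : Submodule A L) → ∃ b ∈ J ^ (n - k), a • v = b • v := by
  obtain ⟨k, hk⟩ := J.exists_pow_inf_eq_pow_smul ((⊤ : Submodule A A).map
    (LinearMap.toSpanSingleton A L v))
  refine ⟨k, fun n a ha => ?_⟩
  rcases le_total k n with hn | hn
  · have h : a • v ∈ J ^ n • (⊤ : Submodule A L) ⊓
        (⊤ : Submodule A A).map (LinearMap.toSpanSingleton A L v) := ⟨ha, a, trivial, rfl⟩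
    rw [hk n hn] at h
    have h := Submodule.smul_mono le_rfl inf_le_right h
    rw [← Submodule.map_smul'', smul_eq_mul, Ideal.mul_top] at h
    obtain ⟨b, hb, hbv⟩ := h
    exact ⟨b, hb, hbv.symm⟩
  · exact ⟨a, by simp [Nat.sub_eq_zero_of_le hn], rfl⟩

variable [IsLocalRing A] [IsNoetherianRing A]

-- Multiplication by x on A/(p + J^n) has cokernel A/(x, p, J^n). Since x is a nonzerodivisor on
-- A/p, Artin-Rees puts the annihilator of x in A/(p + J^n) inside the image of J^(n-k).
omit [IsLocalRing A] in
theorem exists_relLength_add_le {J p : Ideal A} [p.IsPrime] {x : A} (hx : x ∉ p) :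
    ∃ k, 0 < k ∧ ∀ n, relLength ⊤ (p ⊔ J ^ (n - k)) + relLength ⊤ (Ideal.span {x} ⊔ p ⊔ J ^ n) ≤
      relLength ⊤ (p ⊔ J ^ n) := by
  obtain ⟨k, hk⟩ := exists_artinRees_cyclic J (p.mkQ x)
  -- One more than the Artin-Rees constant, so that the shift is positive.
  refine ⟨k + 1, k.succ_pos, fun n => ?_⟩
  have hspan : (⊤ : Submodule A A).map (LinearMap.lsmul A A x) = Ideal.span {x} := by
    ext y
    simp [Ideal.mem_span_singleton', mul_comm]
  have hcomap : Submodule.comap (LinearMap.lsmul A A x) (p ⊔ J ^ n) ≤ p ⊔ J ^ (n - (k + 1)) := by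
    intro a ha
    have ha' : a • p.mkQ x ∈ J ^ n • (⊤ : Submodule A (A ⧸ p)) := by
      rw [← map_smul, mkQ_mem_smul_top_iff, smul_eq_mul, mul_comm]
      exact ha
    obtain ⟨b, hb, hab⟩ := hk n a ha'
    have h : (a - b) * x ∈ p := by
      rw [← map_smul, ← map_smul, ← sub_eq_zero, ← map_sub, ← sub_smul] at hab
      exact Ideal.Quotient.eq_zero_iff_mem.1 hab
    have h := (Ideal.IsPrime.mem_or_mem ‹_› h).resolve_right hx
    rw [← sub_add_cancel a b]
    exact add_mem (Ideal.mem_sup_left h)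
      (Ideal.mem_sup_right (Ideal.pow_le_pow_right (by omega) hb))
  rw [sup_assoc, relLength_add (U := ⊤) (W := Ideal.span {x} ⊔ (p ⊔ J ^ n)) le_sup_right le_top,
    relLength_sup, ← hspan, relLength_map, add_comm]
  gcongr
  exact relLength_anti_right _ hcomap

/-- The length of a chain of primes above `p` is bounded by the order of growth of the
Hilbert-Samuel function of `A / p`. -/
theorem length_le_of_relLength_le {J : Ideal A} (hJ : J ≤ maximalIdeal A) (d : ℕ) :
    ∀ (p : Ideal A), p.IsPrime → ∀ C : ℕ,
      (∀ n, 0 < n → relLength ⊤ (p ⊔ J ^ n) ≤ ((C * n ^ d : ℕ) : ℕ∞)) →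
      ∀ s : LTSeries (PrimeSpectrum A), p ≤ s.head.asIdeal → s.length ≤ d := by
  induction d with
  | zero =>
    intro p hp C hC s hps
    by_contra! hs
    have hlt : s.head < s ⟨1, by omega⟩ := s.strictMono (by
      rw [Fin.lt_def]
      exact Nat.zero_lt_one)
    obtain ⟨x, hx1, hx⟩ := SetLike.exists_of_lt (PrimeSpectrum.asIdeal_lt_asIdeal _ _ |>.2 hlt)
    obtain ⟨k, hk0, hk⟩ := exists_relLength_add_le (J := J) (p := p) fun h => hx (hps h)
    have hone : ∀ n, 0 < n → 1 ≤ relLength ⊤ (Ideal.span {x} ⊔ p ⊔ J ^ n) := by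
      intro n hn
      rw [Order.one_le_iff_pos, pos_iff_ne_zero, Ne, relLength_eq_zero_iff, top_le_iff]
      refine ((sup_le (sup_le ?_ ?_) ?_).trans_lt (maximalIdeal.isMaximal A).ne_top.lt_top).ne
      · rw [Ideal.span_singleton_le_iff_mem]
        exact le_maximalIdeal (s ⟨1, by omega⟩).isPrime.ne_top hx1
      · exact le_maximalIdeal hp.ne_top
      · exact (Ideal.pow_le_self hn.ne').trans hJ
    -- Each shift by k adds at least 1, so the function is unbounded, contrary to the bound C of
    -- degree 0.
    have hgrow : ∀ m : ℕ, (m : ℕ∞) ≤ relLength ⊤ (p ⊔ J ^ (m * k)) := by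
      intro m
      induction m with
      | zero => simp
      | succ m ih =>
        have h := hk ((m + 1) * k)
        rw [Nat.succ_mul, Nat.add_sub_cancel] at h
        rw [Nat.succ_mul]
        refine le_trans ?_ h
        push_cast
        exact add_le_add ih (hone _ (by omega))
    have h := (hgrow (C + 1)).trans (hC ((C + 1) * k) (Nat.mul_pos C.succ_pos hk0))
    have h := Nat.cast_le.1 h
    simp at h
  | succ d ih =>
    intro p hp C hC s hps
    by_cases hs : s.length = 0
    · omega
    have hlt : s.head < s ⟨1, by omega⟩ := s.strictMono (by
      rw [Fin.lt_def]
      exact Nat.zero_lt_one)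
    obtain ⟨x, hx1, hx⟩ := SetLike.exists_of_lt (PrimeSpectrum.asIdeal_lt_asIdeal _ _ |>.2 hlt)
    obtain ⟨k, hk0, hk⟩ := exists_relLength_add_le (J := J) (p := p) fun h => hx (hps h)
    -- Iterating the inequality m times; T = m = n then bounds the growth for A/(x, p) by one degree
    -- less. A prime minimal over (x) + p inside the second member of the chain continues the
    -- induction.
    have hgrow : ∀ T m : ℕ, (m : ℕ∞) * relLength ⊤ (Ideal.span {x} ⊔ p ⊔ J ^ (T * k)) ≤
        relLength ⊤ (p ⊔ J ^ ((T + m) * k)) := by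
      intro T m
      induction m with
      | zero => simp
      | succ m ih =>
        have h := hk ((T + (m + 1)) * k)
        rw [← add_assoc, Nat.succ_mul, Nat.add_sub_cancel] at h
        rw [← add_assoc, Nat.succ_mul]
        refine le_trans ?_ h
        push_cast
        rw [add_mul, one_mul]
        refine add_le_add ih (relLength_anti_right _ (sup_le_sup_left
          (Ideal.pow_le_pow_right ?_) _))
        rw [Nat.add_mul]
        omega
    have hbound : ∀ n, 0 < n → relLength ⊤ (Ideal.span {x} ⊔ p ⊔ J ^ n) ≤
        ((C * (2 * k) ^ (d + 1) * n ^ d : ℕ) : ℕ∞) := by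
      intro n hn
      refine (relLength_anti_right _ (sup_le_sup_left
          (Ideal.pow_le_pow_right (Nat.le_mul_of_pos_right n hk0)) _)).trans ?_
      have h := (hgrow n n).trans (hC _ (Nat.mul_pos (by omega) hk0))
      have h' : ((C * ((n + n) * k) ^ (d + 1) : ℕ) : ℕ∞) =
          (n : ℕ∞) * ((C * (2 * k) ^ (d + 1) * n ^ d : ℕ) : ℕ∞) := by
        rw [← Nat.cast_mul]
        congr 1
        rw [show (n + n) * k = (2 * k) * n by ring, mul_pow]
        ring
      rw [h'] at h
      exact (ENat.mul_le_mul_left_iff (by simpa using hn.ne') (ENat.natCast_ne_top n)).1 h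
    obtain ⟨p', hp', hp'1⟩ := Ideal.exists_minimalPrimes_le (I := Ideal.span {x} ⊔ p)
      (J := (s ⟨1, by omega⟩).asIdeal) (sup_le ((Ideal.span_singleton_le_iff_mem _).2 hx1)
        (hps.trans hlt.le))
    have := ih p' hp'.1.1 _ (fun n hn => (relLength_anti_right _
      (sup_le_sup_right hp'.1.2 _)).trans (hbound n hn)) (s.tail hs) (by
        rw [RelSeries.head_tail]
        have h1 : (1 : Fin (s.length + 1)) = ⟨1, by omega⟩ :=
          Fin.ext (Nat.mod_eq_of_lt (Nat.succ_lt_succ (Nat.pos_of_ne_zero hs)))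
        rw [h1]
        exact hp'1)
    rw [RelSeries.tail_length] at this
    omega

/-- The prime at the head of a chain in the support contains an associated prime p, so A/p embeds in
L. Artin-Rees transfers the growth bound from L to A/p with the same exponent. -/
theorem supportDim_le_of_relLength_le [Module.Finite A L] {J : Ideal A}
    (hJ : J ≤ maximalIdeal A) {C d : ℕ}
    (h : ∀ n, 0 < n → relLength ⊤ (J ^ n • (⊤ : Submodule A L)) ≤ ((C * n ^ d : ℕ) : ℕ∞)) :
    Module.supportDim A L ≤ d := by
  rw [Module.supportDim, Order.krullDim]
  refine iSup_le fun s => ?_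
  obtain ⟨p, hp, hps⟩ := Ideal.exists_minimalPrimes_le
    (Module.annihilator_le_of_mem_support s.head.2)
  have hprime : p.IsPrime := hp.1.1
  obtain ⟨_, v, hv⟩ := (isAssociatedPrime_iff_exists_injective_linearMap _ _).1
    (Module.associatedPrimes.minimalPrimes_annihilator_subset_associatedPrimes A L hp)
  obtain ⟨k, hk⟩ := exists_artinRees_cyclic J (v 1)
  have hker : ∀ a : A, a • v 1 = 0 → a ∈ p := by
    intro a ha
    rw [← map_smul] at ha
    have := hv (ha.trans v.map_zero.symm)
    rwa [Algebra.smul_def, mul_one, Ideal.Quotient.algebraMap_eq,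
      Ideal.Quotient.eq_zero_iff_mem] at this
  have hcomap : ∀ n, (J ^ n • (⊤ : Submodule A L)).comap (LinearMap.toSpanSingleton A L (v 1)) ≤
      p ⊔ J ^ (n - k) := by
    intro n a ha
    obtain ⟨b, hb, hab⟩ := hk n a ha
    rw [← sub_add_cancel a b]
    exact add_mem (Ideal.mem_sup_left (hker _ (by rw [sub_smul, hab, sub_self])))
      (Ideal.mem_sup_right hb)
  have hbound : ∀ n, 0 < n → relLength ⊤ (p ⊔ J ^ n) ≤ ((C * (k + 1) ^ d * n ^ d : ℕ) : ℕ∞) := by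
    intro n hn
    have h1 := hcomap (n + k)
    rw [Nat.add_sub_cancel] at h1
    refine (relLength_anti_right _ h1).trans ?_
    rw [← relLength_map]
    refine (relLength_mono_left _ le_top).trans ((h _ (by omega)).trans ?_)
    rw [mul_assoc, ← mul_pow]
    have h2 : n + k ≤ (k + 1) * n := by nlinarith
    exact_mod_cast Nat.mul_le_mul_left C (Nat.pow_le_pow_left h2 d)
  have := length_le_of_relLength_le hJ d p hprime _ hbound
    (s.map Subtype.val fun _ _ h => h) hps
  exact_mod_cast this

theorem isArtinianRing_quotient_of_pow_le {B : Ideal A} {e : ℕ} (h : maximalIdeal A ^ e ≤ B) :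
    IsArtinianRing (A ⧸ B) := by
  by_cases hB : B = ⊤
  · have : Subsingleton (A ⧸ B) := Ideal.Quotient.subsingleton_iff.2 hB
    infer_instance
  have : Nontrivial (A ⧸ B) := Ideal.Quotient.nontrivial_iff.2 hB
  have : IsLocalRing (A ⧸ B) :=
    IsLocalRing.of_surjective' (Ideal.Quotient.mk B) Ideal.Quotient.mk_surjective
  rw [isArtinianRing_iff_isNilpotent_maximalIdeal]
  refine ⟨e, ?_⟩
  have hm : maximalIdeal (A ⧸ B) ≤ (maximalIdeal A).map (Ideal.Quotient.mk B) := by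
    intro y hy
    obtain ⟨a, rfl⟩ := Ideal.Quotient.mk_surjective y
    refine Ideal.mem_map_of_mem _ ?_
    rw [mem_maximalIdeal, mem_nonunits_iff] at hy ⊢
    exact fun ha => hy (ha.map _)
  rw [Ideal.zero_eq_bot, eq_bot_iff]
  refine (Ideal.pow_right_mono hm e).trans ?_
  rw [← Ideal.map_pow, Ideal.map_le_iff_le_comap]
  intro a ha
  exact Ideal.mem_comap.2 ((Ideal.mem_bot).2 (Ideal.Quotient.eq_zero_iff_mem.2 (h ha)))

theorem relLength_smul_ne_top [Module.Finite A L] {B : Ideal A} {e : ℕ}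
    (h : maximalIdeal A ^ e ≤ B) (U : Submodule A L) : relLength U (B • U) ≠ ⊤ := by
  have := isArtinianRing_quotient_of_pow_le h
  have hfin : Module.length A (U ⧸ (B • ⊤ : Submodule A U)) ≠ ⊤ := by
    rw [Module.length_eq_of_surjective (R := A ⧸ B) Ideal.Quotient.mk_surjective]
    have : Module.Finite (A ⧸ B) (U ⧸ (B • ⊤ : Submodule A U)) :=
      Module.Finite.of_restrictScalars_finite A _ _
    exact Module.length_ne_top
  refine ne_top_of_le_ne_top hfin ?_
  rw [← relLength_top]
  have hU : relLength U (B • U) = relLength ((⊤ : Submodule A U).map U.subtype) (B • U) := by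
    rw [Submodule.map_top, Submodule.range_subtype]
  rw [hU, relLength_map]
  refine relLength_anti_right _ ?_
  rw [← Submodule.map_le_iff_le_comap, Submodule.map_smul'', Submodule.map_top,
    Submodule.range_subtype]

-- Each step of the chain W + x^i L has a quotient that is an image, under multiplication by x^i, of
-- L/(W + xL).
omit [IsLocalRing A] [IsNoetherianRing A] in
theorem relLength_sup_pow_le (W : Submodule A L) (x : A) (n : ℕ) :
    relLength ⊤ (W ⊔ (⊤ : Submodule A L).map (LinearMap.lsmul A L (x ^ n))) ≤
      n * relLength ⊤ (W ⊔ (⊤ : Submodule A L).map (LinearMap.lsmul A L x)) := by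
  induction n with
  | zero =>
    rw [relLength_eq_zero_iff.2]
    · simp
    · intro v _
      exact Submodule.mem_sup_right ⟨v, trivial, by simp⟩
  | succ n ih =>
    have hle : (⊤ : Submodule A L).map (LinearMap.lsmul A L (x ^ (n + 1))) ≤
        (⊤ : Submodule A L).map (LinearMap.lsmul A L (x ^ n)) := by
      rintro _ ⟨v, _, rfl⟩
      refine ⟨x • v, trivial, ?_⟩
      change x ^ n • x • v = x ^ (n + 1) • v
      rw [pow_succ, mul_smul]
    rw [relLength_add (sup_le_sup_left hle W) le_top]
    push_cast
    rw [add_mul, one_mul]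
    refine add_le_add ih ?_
    have : W ⊔ (⊤ : Submodule A L).map (LinearMap.lsmul A L (x ^ n)) =
        (⊤ : Submodule A L).map (LinearMap.lsmul A L (x ^ n)) ⊔
          (W ⊔ (⊤ : Submodule A L).map (LinearMap.lsmul A L (x ^ (n + 1)))) := by
      rw [sup_left_comm, sup_eq_left.2 hle]
    rw [this, relLength_sup, relLength_map]
    refine relLength_anti_right _ (sup_le ?_ ?_)
    · intro w hw
      exact Submodule.mem_sup_left (W.smul_mem _ hw)
    · rintro _ ⟨v, _, rfl⟩
      refine Submodule.mem_sup_right ⟨v, trivial, ?_⟩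
      change x ^ (n + 1) • v = x ^ n • x • v
      rw [pow_succ, mul_smul]

omit [IsLocalRing A] [IsNoetherianRing A] in
theorem relLength_sup_iSup_pow_le [DecidableEq A] (s : Finset A) (n : ℕ) :
    ∀ W : Submodule A L,
      relLength ⊤ (W ⊔ ⨆ x ∈ s, (⊤ : Submodule A L).map (LinearMap.lsmul A L (x ^ n))) ≤
        (n : ℕ∞) ^ s.card *
          relLength ⊤ (W ⊔ ⨆ x ∈ s, (⊤ : Submodule A L).map (LinearMap.lsmul A L x)) := by
  induction s using Finset.induction_on with
  | empty => simp
  | insert y s hy ih =>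
    intro W
    rw [Finset.iSup_insert, Finset.iSup_insert, Finset.card_insert_of_notMem hy,
      pow_succ, mul_assoc]
    have h1 := ih (W ⊔ (⊤ : Submodule A L).map (LinearMap.lsmul A L (y ^ n)))
    have h2 := relLength_sup_pow_le
      (W ⊔ ⨆ x ∈ s, (⊤ : Submodule A L).map (LinearMap.lsmul A L x)) y n
    have hcomm : ∀ S R : Submodule A L, W ⊔ S ⊔ R = W ⊔ (R ⊔ S) := fun S R => by
      rw [sup_assoc, sup_comm S]
    rw [sup_assoc, sup_assoc] at h1
    rw [hcomm, hcomm] at h2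
    exact h1.trans (mul_le_mul' le_rfl h2)

/-- A Noetherian local ring of dimension `q` modulo `𝔠` has a system of at most `q` parameters
modulo `𝔠`. -/
theorem exists_parameters {𝔠 : Ideal A} {q : ℕ} (hq : ringKrullDim (A ⧸ 𝔠) = q) :
    ∃ s : Finset A, s.card ≤ q ∧ (∀ x ∈ s, x ∈ maximalIdeal A) ∧
      ∃ e, maximalIdeal A ^ e ≤ Ideal.span (s : Set A) ⊔ 𝔠 := by
  classical
  have hne : 𝔠 ≠ ⊤ := by
    rintro rfl
    rw [ringKrullDim_eq_bot_of_subsingleton] at hq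
    simp at hq
  have : Nontrivial (A ⧸ 𝔠) := Ideal.Quotient.nontrivial_iff.2 hne
  have : IsLocalRing (A ⧸ 𝔠) :=
    IsLocalRing.of_surjective' (Ideal.Quotient.mk 𝔠) Ideal.Quotient.mk_surjective
  obtain ⟨t, ht, hcard⟩ :=
    (maximalIdeal (A ⧸ 𝔠)).exists_finset_card_eq_height_of_isNoetherianRing
  obtain ⟨o, hmk⟩ : ∃ o : A ⧸ 𝔠 → A, ∀ y, Ideal.Quotient.mk 𝔠 (o y) = y :=
    ⟨_, Function.surjInv_eq Ideal.Quotient.mk_surjective⟩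
  refine ⟨t.image o, ?_, ?_, ?_⟩
  · refine Finset.card_image_le.trans ?_
    rw [← maximalIdeal_height_eq_ringKrullDim, ← hcard] at hq
    exact_mod_cast hq.le
  · intro x hx
    obtain ⟨y, hy, rfl⟩ := Finset.mem_image.1 hx
    have hy' : y ∈ maximalIdeal (A ⧸ 𝔠) := ht.1.2 (Ideal.subset_span hy)
    rw [mem_maximalIdeal, mem_nonunits_iff] at hy' ⊢
    intro hu
    exact hy' (hmk y ▸ hu.map (Ideal.Quotient.mk 𝔠))
  · obtain ⟨e, he⟩ := (Ideal.span ((t.image o : Finset A) : Set A) ⊔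
      𝔠).exists_radical_pow_le_of_fg (IsNoetherian.noetherian _)
    refine ⟨e, (Ideal.pow_right_mono ?_ e).trans he⟩
    -- Any prime containing the lifted elements and 𝔠 maps to a prime of A/𝔠 over which the maximal
    -- ideal is minimal, so it is maximal.
    rw [Ideal.radical_eq_sInf]
    refine le_sInf ?_
    rintro P ⟨hP, hPp⟩
    have hcP : 𝔠 ≤ P := le_sup_right.trans hP
    have hker : RingHom.ker (Ideal.Quotient.mk 𝔠) ≤ P := by rwa [Ideal.mk_ker]
    have hprime : (P.map (Ideal.Quotient.mk 𝔠)).IsPrime :=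
      Ideal.map_isPrime_of_surjective Ideal.Quotient.mk_surjective hker
    have hle : maximalIdeal (A ⧸ 𝔠) ≤ P.map (Ideal.Quotient.mk 𝔠) := by
      refine ht.2 ⟨hprime, Ideal.span_le.2 fun y hy => ?_⟩ (le_maximalIdeal hprime.ne_top)
      rw [← hmk y]
      refine Ideal.mem_map_of_mem _ (hP (Ideal.mem_sup_left (Ideal.subset_span ?_)))
      exact Finset.mem_coe.2 (Finset.mem_image_of_mem _ hy)
    have : P.map (Ideal.Quotient.mk 𝔠) = maximalIdeal (A ⧸ 𝔠) :=
      le_antisymm (le_maximalIdeal hprime.ne_top) hle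
    intro x hx
    have hx' : Ideal.Quotient.mk 𝔠 x ∈ P.map (Ideal.Quotient.mk 𝔠) := by
      refine hle ?_
      have := Ideal.map_le_iff_le_comap.1 (le_maximalIdeal (J := (maximalIdeal A).map
        (Ideal.Quotient.mk 𝔠)) ?_)
      · exact this hx
      · intro htop
        have h1 := (Ideal.comap_map_of_surjective' (Ideal.Quotient.mk 𝔠)
          Ideal.Quotient.mk_surjective (maximalIdeal A))
        rw [htop, Ideal.comap_top, Ideal.mk_ker, sup_eq_left.2 (le_maximalIdeal hne)] at h1
        exact (maximalIdeal.isMaximal A).ne_top h1.symm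
    have := Ideal.comap_map_of_surjective' (Ideal.Quotient.mk 𝔠)
      Ideal.Quotient.mk_surjective P
    rw [Ideal.mk_ker, sup_eq_left.2 hcP] at this
    rw [← this]
    exact hx'

/-- J^n L contains fixed multiples of the n-th powers of at most q parameters applied to L, and
raising each parameter to the power N multiplies the length by at most N. -/
theorem exists_relLength_pow_le [Module.Finite A L] {𝔠 J : Ideal A} {q r : ℕ}
    (hc : 𝔠 ≤ Module.annihilator A L) (hq : ringKrullDim (A ⧸ 𝔠) = q)
    (hJ : maximalIdeal A ^ r ≤ J) :
    ∃ C : ℕ, ∀ n, 0 < n → relLength ⊤ (J ^ n • (⊤ : Submodule A L)) ≤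
      ((C * n ^ q : ℕ) : ℕ∞) := by
  classical
  obtain ⟨s, hs, hsm, e, he⟩ := exists_parameters hq
  have hspan : ∀ k, maximalIdeal A ^ k ≤ Ideal.span (s : Set A) ⊔ 𝔠 →
      maximalIdeal A ^ k • (⊤ : Submodule A L) ≤
        ⨆ x ∈ s, (⊤ : Submodule A L).map (LinearMap.lsmul A L x) := by
    intro k hk
    refine Submodule.smul_le.2 fun a ha v _ => ?_
    obtain ⟨b, hb, c, hc', rfl⟩ := Submodule.mem_sup.1 (hk ha)
    rw [add_smul, Module.mem_annihilator.1 (hc hc') v, add_zero]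
    clear ha
    induction hb using Submodule.span_induction with
    | mem x hx => exact Submodule.mem_iSup_of_mem x (Submodule.mem_iSup_of_mem hx ⟨v, trivial, rfl⟩)
    | zero => simp
    | add x y _ _ hx hy => simpa [add_smul] using add_mem hx hy
    | smul r x _ hx => simpa [mul_smul] using Submodule.smul_mem _ r hx
  have hfin : relLength ⊤ (⨆ x ∈ s, (⊤ : Submodule A L).map (LinearMap.lsmul A L x)) ≠ ⊤ :=
    ne_top_of_le_ne_top (relLength_smul_ne_top (le_refl (maximalIdeal A ^ e)) _)
      (relLength_anti_right _ (hspan e he))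
  obtain ⟨C, hC⟩ := ENat.ne_top_iff_exists.1 hfin
  -- Using r + 1 instead of r keeps the base (r + 1)n positive, as needed to raise the exponent from
  -- `s.card` to q.
  refine ⟨(r + 1) ^ q * C, fun n hn => ?_⟩
  have hle : ⊥ ⊔ ⨆ x ∈ s, (⊤ : Submodule A L).map (LinearMap.lsmul A L (x ^ ((r + 1) * n))) ≤
      J ^ n • (⊤ : Submodule A L) := by
    rw [bot_sup_eq]
    refine iSup₂_le fun x hx => ?_
    rintro _ ⟨v, _, rfl⟩
    refine Submodule.smul_mem_smul ?_ trivial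
    have := Ideal.pow_le_pow_right (Nat.le_succ r) (Ideal.pow_mem_pow (hsm x hx) (r + 1))
    rw [pow_mul]
    exact Ideal.pow_mem_pow (hJ this) n
  refine (relLength_anti_right _ hle).trans ((relLength_sup_iSup_pow_le s _ _).trans ?_)
  rw [bot_sup_eq, ← hC]
  have h1 : ((r + 1) * n) ^ s.card ≤ ((r + 1) * n) ^ q :=
    Nat.pow_le_pow_right (Nat.mul_pos r.succ_pos hn) hs
  have h2 : ((r + 1) * n) ^ s.card * C ≤ (r + 1) ^ q * C * n ^ q := by
    refine (Nat.mul_le_mul_right C h1).trans (le_of_eq ?_)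
    rw [mul_pow]
    ring
  exact_mod_cast h2

end HilbertSamuel

/-! ### Degree and growth of polynomials -/

section PolynomialGrowth

variable {ι : Type*}

theorem MvPolynomial.eval_smul_eq_sum_homogeneousComponent (P : MvPolynomial ι ℚ) (c : ι → ℚ)
    (t : ℚ) : MvPolynomial.eval (fun i => t * c i) P =
      ∑ k ∈ Finset.range (P.totalDegree + 1),
        MvPolynomial.eval c (MvPolynomial.homogeneousComponent k P) * t ^ k := by
  conv_lhs => rw [← MvPolynomial.sum_homogeneousComponent P]
  rw [map_sum]
  refine Finset.sum_congr rfl fun k _ => ?_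
  have h := MvPolynomial.homogeneousComponent_isHomogeneous k P
  rw [MvPolynomial.eval_eq, MvPolynomial.eval_eq, Finset.sum_mul]
  refine Finset.sum_congr rfl fun m hm => ?_
  have hdeg := h (MvPolynomial.mem_support_iff.1 hm)
  have hsum : ∑ i ∈ m.support, m i = k := by
    rw [← hdeg, Finsupp.weight_apply, Finsupp.sum]
    simp
  simp_rw [mul_pow]
  rw [Finset.prod_mul_distrib, Finset.prod_pow_eq_pow_sum, hsum]
  ring

theorem MvPolynomial.exists_nat_eval_ne_zero {P : MvPolynomial ι ℚ} (hP : P ≠ 0) :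
    ∃ c : ι → ℕ, (∀ i, 0 < c i) ∧ MvPolynomial.eval (fun i => (c i : ℚ)) P ≠ 0 := by
  by_contra! h
  refine hP (MvPolynomial.funext_set (fun _ => Set.range fun k : ℕ => ((k + 1 : ℕ) : ℚ))
    (fun _ => Set.infinite_range_of_injective fun a b hab => ?_) fun x hx => ?_)
  · exact Nat.succ_injective (Nat.cast_injective hab)
  · choose k hk using fun i => hx i trivial
    have hxk : x = fun i => ((k i + 1 : ℕ) : ℚ) := by
      funext i
      exact (hk i).symm
    rw [map_zero, ← h (fun i => k i + 1) fun i => Nat.succ_pos _, hxk]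

/-- On a suitable ray, a polynomial has a restriction of the same degree. -/
theorem MvPolynomial.exists_ray {P : MvPolynomial ι ℚ} (hP : P ≠ 0) :
    ∃ (c : ι → ℕ) (Q : Polynomial ℚ), (∀ i, 0 < c i) ∧
      (P.totalDegree : WithBot ℕ) ≤ Q.degree ∧
      ∀ t : ℚ, Q.eval t = MvPolynomial.eval (fun i => t * (c i : ℚ)) P := by
  have htop : MvPolynomial.homogeneousComponent P.totalDegree P ≠ 0 := by
    obtain ⟨m, hm, hdeg⟩ := Finset.exists_mem_eq_sup P.support
      (MvPolynomial.support_nonempty.2 hP) fun m => m.sum fun _ e => e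
    intro h0
    have h1 := congrArg (MvPolynomial.coeff m) h0
    rw [MvPolynomial.coeff_homogeneousComponent, if_pos, MvPolynomial.coeff_zero] at h1
    · exact MvPolynomial.mem_support_iff.1 hm h1
    · rw [MvPolynomial.totalDegree, hdeg]
      rfl
  obtain ⟨c, hc, hne⟩ := MvPolynomial.exists_nat_eval_ne_zero htop
  refine ⟨c, ∑ k ∈ Finset.range (P.totalDegree + 1), Polynomial.C (MvPolynomial.eval
    (fun i => (c i : ℚ)) (MvPolynomial.homogeneousComponent k P)) * Polynomial.X ^ k, hc, ?_, ?_⟩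
  · refine Polynomial.le_degree_of_ne_zero ?_
    simpa [Polynomial.finsetSum_coeff, Polynomial.coeff_C_mul, Polynomial.coeff_X_pow] using hne
  · intro t
    rw [MvPolynomial.eval_smul_eq_sum_homogeneousComponent]
    simp [Polynomial.eval_finsetSum]

/-- The terms with T ≤ u < 2T alone contribute at least a constant times T^(D+1), which exceeds
C(2T)^q for large T if q ≤ D. -/
theorem Polynomial.lt_of_sum_range_le {Q : Polynomial ℚ} {D q t₀ : ℕ} {C : ℚ}
    (hD : (D : WithBot ℕ) ≤ Q.degree) (hpos : ∀ u : ℕ, 0 ≤ Q.eval ((t₀ + u : ℕ) : ℚ))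
    (hsum : ∀ T : ℕ, 0 < T →
      ∑ u ∈ Finset.range T, Q.eval ((t₀ + u : ℕ) : ℚ) ≤ C * (T : ℚ) ^ q) : D + 1 ≤ q := by
  have hO : (fun x : ℚ => (Polynomial.X ^ D : Polynomial ℚ).eval x) =O[Filter.atTop]
      fun x => Q.eval x := by
    refine Polynomial.isBigO_atTop_of_degree_le _ _ ?_
    rwa [Polynomial.degree_X_pow]
  obtain ⟨K', hK⟩ := hO.bound
  obtain ⟨K, hKK⟩ := exists_nat_ge K'
  obtain ⟨x₀, hx₀⟩ := Filter.eventually_atTop.1 hK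
  by_contra! hlt
  obtain ⟨T, hT⟩ := exists_nat_gt (max (max x₀ 1) (K * C * 2 ^ q))
  have hTx : x₀ < T := (le_max_left _ _).trans_lt ((le_max_left _ _).trans_lt hT)
  have hT1 : (1 : ℚ) < T := (le_max_right _ _).trans_lt ((le_max_left _ _).trans_lt hT)
  have hTC : K * C * 2 ^ q < T := (le_max_right _ _).trans_lt hT
  have hT0 : 0 < T := by
    have : (0 : ℚ) < T := by linarith
    exact_mod_cast this
  have hterm : ∀ u : ℕ, T ≤ u → (T : ℚ) ^ D ≤ K * Q.eval ((t₀ + u : ℕ) : ℚ) := by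
    intro u hu
    have hTu : (T : ℚ) ≤ ((t₀ + u : ℕ) : ℚ) := by exact_mod_cast (by omega : T ≤ t₀ + u)
    have h := hx₀ ((t₀ + u : ℕ) : ℚ) (hTx.le.trans hTu)
    rw [Polynomial.eval_pow, Polynomial.eval_X] at h
    have h' : |((t₀ + u : ℕ) : ℚ) ^ D| ≤ K * |Q.eval ((t₀ + u : ℕ) : ℚ)| := by
      have h2 : ((|((t₀ + u : ℕ) : ℚ) ^ D| : ℚ) : ℝ) ≤
          K * ((|Q.eval ((t₀ + u : ℕ) : ℚ)| : ℚ) : ℝ) := by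
        refine le_trans ?_ (mul_le_mul_of_nonneg_right hKK (by positivity))
        simpa [← Rat.norm_cast_real, Real.norm_eq_abs] using h
      exact_mod_cast h2
    rw [abs_of_nonneg (hpos u), abs_of_nonneg (by positivity)] at h'
    refine (pow_le_pow_left₀ (by positivity) hTu D).trans h'
  have hlow : (T : ℚ) * (T : ℚ) ^ D ≤
      K * ∑ u ∈ Finset.range (2 * T), Q.eval ((t₀ + u : ℕ) : ℚ) := by
    have h1 : (T : ℚ) * (T : ℚ) ^ D ≤ ∑ u ∈ Finset.Ico T (2 * T),
        K * Q.eval ((t₀ + u : ℕ) : ℚ) := by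
      have := Finset.card_nsmul_le_sum (Finset.Ico T (2 * T))
        (fun u => K * Q.eval ((t₀ + u : ℕ) : ℚ)) ((T : ℚ) ^ D)
        fun u hu => hterm u (Finset.mem_Ico.1 hu).1
      rwa [Nat.card_Ico, nsmul_eq_mul, show 2 * T - T = T by omega] at this
    rw [Finset.mul_sum]
    refine h1.trans (Finset.sum_le_sum_of_subset_of_nonneg ?_ fun u _ _ => ?_)
    · intro u hu
      exact Finset.mem_range.2 (Finset.mem_Ico.1 hu).2
    · exact mul_nonneg (Nat.cast_nonneg K) (hpos u)
  have hup := mul_le_mul_of_nonneg_left (hsum (2 * T) (by omega)) (Nat.cast_nonneg K)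
  have hpow : (T : ℚ) * (T : ℚ) ^ q ≤ (T : ℚ) * (T : ℚ) ^ D :=
    mul_le_mul_of_nonneg_left (pow_le_pow_right₀ hT1.le (by omega)) (by positivity)
  have hfinal : (T : ℚ) * (T : ℚ) ^ q ≤ K * C * 2 ^ q * (T : ℚ) ^ q := by
    refine hpow.trans (hlow.trans (hup.trans (le_of_eq ?_)))
    push_cast
    rw [mul_pow]
    ring
  exact absurd (le_of_mul_le_mul_right hfinal (by positivity)) (not_le.2 hTC)

theorem MvPolynomial.exists_abs_eval_le (P : MvPolynomial ι ℚ) :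
    ∃ K : ℕ, ∀ (R : ℚ) (v : ι → ℚ), 1 ≤ R → (∀ i, |v i| ≤ R) →
      |MvPolynomial.eval v P| ≤ K * R ^ P.totalDegree := by
  obtain ⟨K, hK⟩ := exists_nat_ge (∑ m ∈ P.support, |P.coeff m|)
  refine ⟨K, fun R v hR hv => ?_⟩
  rw [MvPolynomial.eval_eq]
  refine (Finset.abs_sum_le_sum_abs _ _).trans ?_
  refine le_trans ?_ (mul_le_mul_of_nonneg_right hK (by positivity))
  rw [Finset.sum_mul]
  refine Finset.sum_le_sum fun m hm => ?_
  rw [abs_mul, Finset.abs_prod]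
  refine mul_le_mul_of_nonneg_left ?_ (abs_nonneg _)
  have h1 : ∏ i ∈ m.support, |v i ^ m i| ≤ ∏ i ∈ m.support, R ^ m i := by
    refine Finset.prod_le_prod (fun i _ => abs_nonneg _) fun i _ => ?_
    rw [abs_pow]
    exact pow_le_pow_left₀ (abs_nonneg _) (hv i) _
  rw [Finset.prod_pow_eq_pow_sum] at h1
  exact h1.trans (pow_le_pow_right₀ hR (MvPolynomial.le_totalDegree hm))

end PolynomialGrowth

/-! ### Polynomiality and degree for torsion-free products -/

section MultiplicityPolynomial

open IsLocalRing

variable {A : Type*} [CommRing A] {M : Type*} [AddCommGroup M] [Module A M]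

theorem relLength_smul_top_submodule (S : Submodule A M) (B B' : Ideal A) :
    relLength (B • (⊤ : Submodule A S)) (B' • ⊤) = relLength (B • S) (B' • S) := by
  have h : ∀ B : Ideal A, (B • (⊤ : Submodule A S)).map S.subtype = B • S := fun B => by
    rw [Submodule.map_smul'', Submodule.map_top, Submodule.range_subtype]
  rw [← h B, ← h B', relLength_map,
    Submodule.comap_map_eq_of_injective S.injective_subtype]

/-- A linear form of the Artin-Rees lemma: if `𝔞 ⊆ J`, then the lengths of `𝔞ⁿL / J𝔞ⁿL` for
`n < T` add up to at most the length of `L / J^(kT+1)L`. -/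
theorem exists_sum_relLength_le [IsNoetherianRing A] (L : Type*) [AddCommGroup L] [Module A L]
    [Module.Finite A L] {J 𝔞 : Ideal A} (h𝔞 : 𝔞 ≤ J) :
    ∃ k, ∀ T, ∑ n ∈ Finset.range T, relLength (𝔞 ^ n • (⊤ : Submodule A L))
      ((J * 𝔞 ^ n) • ⊤) ≤ relLength ⊤ (J ^ (k * T + 1) • (⊤ : Submodule A L)) := by
  obtain ⟨k, hk⟩ := exists_uniform_artinRees L J 𝔞
  -- Each increase of n costs k powers of J. For e = kT + 1 and n < T at least one power remains, so
  -- modulo J^(kT+1) L the n-th quotient still surjects onto 𝔞^n L / J𝔞^n L.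
  have hlin : ∀ e n, J ^ e • (⊤ : Submodule A L) ⊓ 𝔞 ^ n • ⊤ ≤
      (J ^ (e - k * n) * 𝔞 ^ n) • ⊤ := by
    intro e n
    induction n with
    | zero => simp
    | succ n ih =>
      have h1 : 𝔞 ^ (n + 1) • (⊤ : Submodule A L) ≤ 𝔞 ^ n • ⊤ :=
        Submodule.smul_mono_left (Ideal.pow_le_pow_right (Nat.le_succ n))
      have h2 := hk (e - k * n) n
      rw [Nat.sub_sub, ← Nat.mul_succ] at h2
      exact (le_inf ((inf_le_inf_left _ h1).trans ih) inf_le_right).trans h2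
  refine ⟨k, fun T => ?_⟩
  let U : Submodule A L := J ^ (k * T + 1) • ⊤
  have hW : Antitone fun n => 𝔞 ^ n • (⊤ : Submodule A L) ⊔ U := fun m n hmn =>
    sup_le_sup_right (Submodule.smul_mono_left (Ideal.pow_le_pow_right hmn)) U
  have hsum := sum_relLength_of_antitone hW T
  refine le_trans ?_ (hsum.le.trans ((relLength_mono_left _ le_top).trans
    (relLength_anti_right _ le_sup_right)))
  refine Finset.sum_le_sum fun n hn => ?_
  have hn : n < T := Finset.mem_range.1 hn
  have hsucc : 𝔞 ^ (n + 1) • (⊤ : Submodule A L) ≤ (J * 𝔞 ^ n) • ⊤ := by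
    rw [pow_succ']
    exact Submodule.smul_mono_left (Ideal.mul_mono_left h𝔞)
  have hsucc' : 𝔞 ^ (n + 1) • (⊤ : Submodule A L) ≤ 𝔞 ^ n • ⊤ :=
    Submodule.smul_mono_left (Ideal.pow_le_pow_right (Nat.le_succ n))
  have hU : U ⊓ 𝔞 ^ n • ⊤ ≤ (J * 𝔞 ^ n) • (⊤ : Submodule A L) := by
    refine (hlin (k * T + 1) n).trans (Submodule.smul_mono_left (Ideal.mul_mono_left ?_))
    refine Ideal.pow_le_self ?_
    have := Nat.mul_le_mul_left k hn.le
    omega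
  have heq : 𝔞 ^ n • (⊤ : Submodule A L) ⊔ U =
      𝔞 ^ n • ⊤ ⊔ (𝔞 ^ (n + 1) • ⊤ ⊔ U) := by
    rw [← sup_assoc, sup_eq_left.2 hsucc']
  rw [heq, relLength_sup, ← relLength_inf _ (𝔞 ^ (n + 1) • (⊤ : Submodule A L) ⊔ U)]
  refine relLength_anti_right _ ?_
  rw [inf_comm, sup_inf_assoc_of_le U hsucc']
  exact sup_le hsucc hU

variable {ι : Type*} [Fintype ι]

/-- The submodule `(H₁)_{n₁} ⋯ (H_r)_{n_r} M` for sequences of ideals `H₁, …, H_r`. -/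
def idealProduct (M : Type*) [AddCommGroup M] [Module A M] (H : ι → ℕ → Ideal A) (n : ι → ℕ) :
    Submodule A M :=
  (∏ i, H i (n i)) • ⊤

theorem idealProduct_add {H : ι → ℕ → Ideal A} {J : ι → Ideal A} {N : ℕ}
    (hH : ∀ i n a, N ≤ n → H i (n + a) = J i ^ a * H i n) {n : ι → ℕ} (hn : ∀ i, N ≤ n i)
    (m : ι → ℕ) : idealProduct M H (n + m) = (∏ i, J i ^ m i) • idealProduct M H n := by
  rw [idealProduct, idealProduct, ← Submodule.mul_smul, ← Finset.prod_mul_distrib]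
  congr 1
  exact Finset.prod_congr rfl fun i _ => hH i _ _ (hn i)

/-- If a kills BM then B kills aM, and elements killed by B vanish; hence passing to the product
module preserves dimension. -/
theorem annihilator_idealProduct {H : ι → ℕ → Ideal A} {n : ι → ℕ}
    (htf : ∀ x : M, (∀ r ∈ ∏ i, H i (n i), r • x = 0) → x = 0) :
    Module.annihilator A (idealProduct M H n) = Module.annihilator A M := by
  refine le_antisymm (fun a ha => ?_) (fun a ha => ?_)
  · rw [Module.mem_annihilator] at ha ⊢
    intro x
    refine htf _ fun r hr => ?_
    have h := congrArg Subtype.val (ha ⟨r • x, Submodule.smul_mem_smul hr trivial⟩)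
    rw [smul_comm]
    exact h
  · rw [Module.mem_annihilator] at ha ⊢
    intro x
    exact Subtype.ext (ha x)

variable [IsLocalRing A] [IsNoetherianRing A] [Module.Finite A M]

/-- On the ray supplied by `MvPolynomial.exists_ray`, P keeps its full degree and its values are the
lengths of 𝔞^u L / J_o 𝔞^u L, whose sums are bounded by a Hilbert-Samuel function. -/
theorem totalDegree_add_one_le_supportDim {H : ι → ℕ → Ideal A} {J : ι → Ideal A} {N : ℕ}
    (hH : ∀ i n a, N ≤ n → H i (n + a) = J i ^ a * H i n) {o : ι} {r q : ℕ}
    (hJ : maximalIdeal A ^ r ≤ J o) (hq : Module.supportDim A M = q)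
    {P : MvPolynomial ι ℚ} (hP0 : P ≠ 0)
    (hP : ∀ n : ι → ℕ, (∀ i, N ≤ n i) →
      ((relLength (idealProduct M H n) (J o • idealProduct M H n)).toNat : ℚ) =
        MvPolynomial.eval (fun i => (n i : ℚ)) P) :
    P.totalDegree + 1 ≤ q := by
  obtain ⟨c, Q, hc, hQ, hPQ⟩ := MvPolynomial.exists_ray hP0
  have hNc : ∀ u i, N ≤ (N + u) * c i := fun u i =>
    (Nat.le_add_right N u).trans (Nat.le_mul_of_pos_right _ (hc i))
  let L := idealProduct M H fun i => N * c i
  let 𝔞 : Ideal A := ∏ i, J i ^ c i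
  have h𝔞 : 𝔞 ≤ J o := by
    classical
    refine (Ideal.prod_le_inf.trans (Finset.inf_le (Finset.mem_univ o))).trans ?_
    exact Ideal.pow_le_self (hc o).ne'
  have hL : ∀ u, idealProduct M H (fun i => (N + u) * c i) = 𝔞 ^ u • L := by
    intro u
    have h := idealProduct_add (M := M) hH (n := fun i => N * c i) (fun i => hNc 0 i)
      fun i => u * c i
    have hpow : ∏ i, J i ^ (u * c i) = 𝔞 ^ u := by
      rw [← Finset.prod_pow]
      exact Finset.prod_congr rfl fun i _ => by rw [mul_comm, pow_mul]
    rw [hpow] at h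
    rw [← h]
    congr 1
    funext i
    exact Nat.add_mul _ _ _
  have hval : ∀ u : ℕ, Q.eval ((N + u : ℕ) : ℚ) =
      ((relLength (𝔞 ^ u • (⊤ : Submodule A L)) ((J o * 𝔞 ^ u) • ⊤)).toNat : ℚ) := by
    intro u
    rw [hPQ, relLength_smul_top_submodule, Submodule.mul_smul, ← hL, hP _ (hNc u)]
    congr 1
    exact congrArg _ (funext fun i => by push_cast; ring)
  have hfin : ∀ u : ℕ,
      relLength (𝔞 ^ u • (⊤ : Submodule A L)) ((J o * 𝔞 ^ u) • ⊤) ≠ ⊤ := by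
    intro u
    rw [Submodule.mul_smul]
    exact relLength_smul_ne_top hJ _
  obtain ⟨k, hk⟩ := exists_sum_relLength_le L h𝔞
  have hann : Module.annihilator A M ≤ Module.annihilator A L := by
    intro a ha
    rw [Module.mem_annihilator] at ha ⊢
    exact fun x => Subtype.ext (ha x)
  rw [Module.supportDim_eq_ringKrullDim_quotient_annihilator] at hq
  obtain ⟨C, hC⟩ := exists_relLength_pow_le hann hq hJ
  refine Polynomial.lt_of_sum_range_le (t₀ := N) (C := C * (k + 1) ^ q) hQ (fun u => ?_)
    fun T hT => ?_
  · rw [hval]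
    positivity
  · have h := (hk T).trans (hC _ (Nat.succ_pos _))
    have h1 : ∑ u ∈ Finset.range T, Q.eval ((N + u : ℕ) : ℚ) =
        ((∑ u ∈ Finset.range T, relLength (𝔞 ^ u • (⊤ : Submodule A L))
          ((J o * 𝔞 ^ u) • ⊤)).toNat : ℚ) := by
      rw [ENat.toNat_sum fun u _ => hfin u, Nat.cast_sum]
      exact Finset.sum_congr rfl fun u _ => hval u
    have h2 := ENat.toNat_le_toNat h (ENat.natCast_ne_top _)
    rw [ENat.toNat_natCast] at h2
    rw [h1]
    have h3 : C * (k * T + 1) ^ q ≤ C * (k + 1) ^ q * T ^ q := by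
      rw [mul_assoc, ← mul_pow]
      exact Nat.mul_le_mul_left C (Nat.pow_le_pow_left (by nlinarith) q)
    exact_mod_cast h2.trans h3

/-- Moving only in direction o, the values of P are lengths of J_o^u L / J_o^(u+1) L. They are
O(u^{deg P}), so their sums bound the Hilbert-Samuel function of L. -/
theorem supportDim_le_totalDegree_add_one [DecidableEq ι] {H : ι → ℕ → Ideal A}
    {J : ι → Ideal A} {N : ℕ}
    (hH : ∀ i n a, N ≤ n → H i (n + a) = J i ^ a * H i n) {o : ι} {r : ℕ}
    (hJ : maximalIdeal A ^ r ≤ J o) (hJm : J o ≤ maximalIdeal A)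
    (htf : ∀ (n : ι → ℕ) (x : M), (∀ r ∈ ∏ i, H i (n i), r • x = 0) → x = 0)
    {P : MvPolynomial ι ℚ}
    (hP : ∀ n : ι → ℕ, (∀ i, N ≤ n i) →
      ((relLength (idealProduct M H n) (J o • idealProduct M H n)).toNat : ℚ) =
        MvPolynomial.eval (fun i => (n i : ℚ)) P) :
    Module.supportDim A M ≤ (P.totalDegree + 1 : ℕ) := by
  let L := idealProduct M H fun _ => N
  have hdim : Module.supportDim A M = Module.supportDim A L := by
    rw [Module.supportDim_eq_ringKrullDim_quotient_annihilator,
      Module.supportDim_eq_ringKrullDim_quotient_annihilator, annihilator_idealProduct (htf _)]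
  obtain ⟨K, hK⟩ := MvPolynomial.exists_abs_eval_le P
  have hL : ∀ u, idealProduct M H ((fun _ => N) + Pi.single o u) = J o ^ u • L := by
    intro u
    rw [idealProduct_add hH fun _ => le_rfl]
    congr 1
    rw [Finset.prod_eq_single o (fun l _ hl => by simp [hl]) (by simp)]
    simp
  have hbound : ∀ u : ℕ, relLength (J o ^ u • (⊤ : Submodule A L)) (J o ^ (u + 1) • ⊤) ≤
      ((K * (N + u + 1) ^ P.totalDegree : ℕ) : ℕ∞) := by
    intro u
    have hfin : relLength (J o ^ u • (⊤ : Submodule A L)) (J o ^ (u + 1) • ⊤) ≠ ⊤ := by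
      rw [pow_succ', Submodule.mul_smul]
      exact relLength_smul_ne_top hJ _
    rw [← ENat.natCast_toNat hfin]
    have h := hP ((fun _ => N) + Pi.single o u) fun i => by simp
    rw [hL, ← Submodule.mul_smul, ← pow_succ', ← relLength_smul_top_submodule] at h
    have h2 := hK (N + u + 1) (fun i => ((((fun _ => N) + Pi.single o u : ι → ℕ) i : ℕ) : ℚ))
      (by have : (0 : ℚ) ≤ N + u := by positivity
          linarith) fun i => by
        rw [Nat.abs_cast]
        have : ((fun _ => N) + Pi.single o u : ι → ℕ) i ≤ N + u + 1 := by
          by_cases hi : i = o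
          · subst hi
            simp
          · simp [hi]
            omega
        exact_mod_cast this
    rw [← h, Nat.abs_cast] at h2
    exact_mod_cast h2
  rw [hdim]
  refine supportDim_le_of_relLength_le hJm (C := K * (N + 1) ^ P.totalDegree) fun n hn => ?_
  have hanti : Antitone fun u => J o ^ u • (⊤ : Submodule A L) := fun a b hab =>
    Submodule.smul_mono_left (Ideal.pow_le_pow_right hab)
  have hsum := sum_relLength_of_antitone hanti n
  have h0 : J o ^ 0 • (⊤ : Submodule A L) = ⊤ := by simp
  simp only [h0] at hsum
  rw [← hsum]
  refine (Finset.sum_le_sum fun u _ => hbound u).trans ?_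
  have h1 : ∀ u ∈ Finset.range n, K * (N + u + 1) ^ P.totalDegree ≤
      K * ((N + 1) * n) ^ P.totalDegree := by
    intro u hu
    have hu : u < n := Finset.mem_range.1 hu
    refine Nat.mul_le_mul_left K (Nat.pow_le_pow_left ?_ _)
    nlinarith [Nat.zero_le (N * (n - 1))]
  have h2 := Finset.sum_le_sum h1
  rw [Finset.sum_const, Finset.card_range, smul_eq_mul, mul_pow] at h2
  have h3 : n * (K * ((N + 1) ^ P.totalDegree * n ^ P.totalDegree)) =
      K * (N + 1) ^ P.totalDegree * n ^ (P.totalDegree + 1) := by ring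
  rw [h3] at h2
  exact_mod_cast h2

/-- The multigraded Hilbert function of a product of filtrations acting without torsion is a polynomial of
degree `dim M - 1`. -/
theorem exists_mvPolynomial_idealProduct [Nontrivial M] {H : ι → ℕ → Ideal A} {J : ι → Ideal A}
    {N : ℕ} (hH : ∀ i n a, N ≤ n → H i (n + a) = J i ^ a * H i n) {o : ι} {r : ℕ}
    (hJ : maximalIdeal A ^ r ≤ J o) (hJm : J o ≤ maximalIdeal A)
    (htf : ∀ (n : ι → ℕ) (x : M), (∀ r ∈ ∏ i, H i (n i), r • x = 0) → x = 0) :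
    ∃ P : MvPolynomial ι ℚ, P ≠ 0 ∧
      Module.supportDim A M = (P.totalDegree : WithBot ℕ∞) + 1 ∧
      ∃ N' : ℕ, ∀ n : ι → ℕ, (∀ i, N' ≤ n i) →
        relLength (idealProduct M H n) (J o • idealProduct M H n) ≠ ⊤ ∧
        ((relLength (idealProduct M H n) (J o • idealProduct M H n)).toNat : ℚ) =
          MvPolynomial.eval (fun i => (n i : ℚ)) P := by
  classical
  let L := idealProduct M H fun _ => N
  obtain ⟨P₀, N₁, hP₀⟩ := exists_mvPolynomial_relLength_pow (L := L) J (J o) fun n => by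
    rw [Submodule.mul_smul]
    exact relLength_smul_ne_top hJ _
  -- The variables of P₀ count from the base point N, hence the translation.
  let P : MvPolynomial ι ℚ :=
    MvPolynomial.aeval (fun i => MvPolynomial.X i - MvPolynomial.C (N : ℚ)) P₀
  have hP : ∀ n : ι → ℕ, (∀ i, N + N₁ ≤ n i) →
      ((relLength (idealProduct M H n) (J o • idealProduct M H n)).toNat : ℚ) =
        MvPolynomial.eval (fun i => (n i : ℚ)) P := by
    intro n hn
    obtain ⟨m, rfl⟩ : ∃ m : ι → ℕ, n = (fun _ => N) + m :=
      ⟨fun i => n i - N, funext fun i => by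
        have := hn i
        simp only [Pi.add_apply]
        omega⟩
    have h := hP₀ m fun i => by
      have := hn i
      simp only [Pi.add_apply] at this
      omega
    rw [relLength_smul_top_submodule, Submodule.mul_smul] at h
    dsimp only [P]
    rw [idealProduct_add hH fun _ => le_rfl, h, MvPolynomial.aeval_def, MvPolynomial.eval₂_eq',
      map_sum, MvPolynomial.eval_eq']
    refine Finset.sum_congr rfl fun d _ => ?_
    simp [MvPolynomial.algebraMap_eq]
  have hH' : ∀ i n a, N + N₁ ≤ n → H i (n + a) = J i ^ a * H i n := fun i n a hn =>
    hH i n a (by omega)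
  -- If P = 0, Nakayama makes a product module zero, so the product of ideals kills a nonzero
  -- element of M.
  have hP0 : P ≠ 0 := by
    intro h0
    have h := hP (fun _ => N + N₁) fun _ => le_rfl
    rw [h0, map_zero, Nat.cast_eq_zero, ENat.toNat_eq_zero,
      or_iff_left (relLength_smul_ne_top hJ _), relLength_eq_zero_iff] at h
    have hbot := Submodule.eq_bot_of_le_smul_of_le_jacobson_bot (J o) _
      (IsNoetherian.noetherian _) h (hJm.trans (maximalIdeal_le_jacobson _))
    obtain ⟨x, hx⟩ := exists_ne (0 : M)
    refine hx (htf (fun _ => N + N₁) x fun a ha => ?_)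
    have : a • x ∈ idealProduct M H fun _ => N + N₁ := Submodule.smul_mem_smul ha trivial
    rwa [hbot, Submodule.mem_bot] at this
  refine ⟨P, hP0, ?_, N + N₁, fun n hn => ⟨relLength_smul_ne_top hJ _, hP n hn⟩⟩
  have hle := supportDim_le_totalDegree_add_one hH' hJ hJm htf hP
  have hbot := Module.supportDim_ne_bot_of_nontrivial A M
  obtain ⟨q, hq⟩ : ∃ q : ℕ, Module.supportDim A M = q := by
    generalize Module.supportDim A M = d at hle hbot
    cases d with
    | bot => exact (hbot rfl).elim
    | coe d =>
      cases d with
      | top => exact absurd (WithBot.coe_le_coe.1 hle) (by simp)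
      | coe d => exact ⟨d, rfl⟩
  have hge := totalDegree_add_one_le_supportDim hH' hJ hq hP0 hP
  rw [hq] at hle ⊢
  have hle' : q ≤ P.totalDegree + 1 := by exact_mod_cast hle
  rw [le_antisymm hle' hge]
  push_cast
  rfl

end MultiplicityPolynomial

/-! ### The I-power torsion submodule -/

section ZeroColonPowers

variable {A : Type*} [CommRing A] {M : Type*} [AddCommGroup M] [Module A M]

/-- The ascending chain of submodules killed by I^n stabilises, so a single power kills all the
torsion. -/
theorem exists_pow_smul_zeroColonPowers_eq_bot [IsNoetherian A M] (I : Ideal A) :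
    ∃ k, I ^ k • zeroColonPowers I M = ⊥ := by
  let T : ℕ →o Submodule A M :=
    { toFun := fun n => Submodule.torsionBySet A M (I ^ n : Ideal A)
      monotone' := fun m n h =>
        Submodule.torsionBySet_le_torsionBySet_of_subset (Ideal.pow_le_pow_right h) }
  obtain ⟨k, hk⟩ := WellFoundedGT.monotone_chain_condition T
  refine ⟨k, (Submodule.eq_bot_iff _).2 fun y hy => ?_⟩
  refine Submodule.smul_induction_on hy (fun a ha x hx => ?_) fun x y hx hy => by
    rw [hx, hy, add_zero]
  obtain ⟨n, hn⟩ := hx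
  have h1 : x ∈ T (max n k) := T.monotone (le_max_left n k)
    ((Submodule.mem_torsionBySet_iff _ _).2 fun a => hn a a.2)
  rw [← hk _ (le_max_right n k)] at h1
  exact (Submodule.mem_torsionBySet_iff _ _).1 h1 ⟨a, ha⟩

theorem zeroColonPowers_ne_top [IsNoetherian A M] {I : Ideal A}
    (hI : ¬ I ≤ (Module.annihilator A M).radical) : zeroColonPowers I M ≠ ⊤ := by
  intro h
  obtain ⟨k, hk⟩ := exists_pow_smul_zeroColonPowers_eq_bot (M := M) I
  rw [h] at hk
  refine hI fun a ha => ⟨k, Module.mem_annihilator.2 fun x => ?_⟩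
  have : a ^ k • x ∈ I ^ k • (⊤ : Submodule A M) :=
    Submodule.smul_mem_smul (Ideal.pow_mem_pow ha k) trivial
  rwa [hk, Submodule.mem_bot] at this

theorem eq_zero_of_pow_smul_eq_zero [IsNoetherian A M] {I : Ideal A} {k : ℕ}
    {x : M ⧸ zeroColonPowers I M} (hx : ∀ a ∈ I ^ k, a • x = 0) : x = 0 := by
  obtain ⟨y, rfl⟩ := Submodule.mkQ_surjective _ x
  obtain ⟨m, hm⟩ := exists_pow_smul_zeroColonPowers_eq_bot (M := M) I
  refine (Submodule.Quotient.mk_eq_zero _).2 ⟨m + k, fun a ha => ?_⟩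
  rw [pow_add] at ha
  refine Submodule.mul_induction_on ha (fun b hb c hc => ?_) fun b c hb hc => by
    rw [add_smul, hb, hc, add_zero]
  have hcy : c • y ∈ zeroColonPowers I M := (Submodule.Quotient.mk_eq_zero _).1 (hx c hc)
  have := Submodule.smul_mem_smul hb hcy
  rwa [hm, Submodule.mem_bot, smul_smul] at this

theorem exists_pow_smul_top_inf_zeroColonPowers_eq_bot [IsNoetherianRing A] [Module.Finite A M]
    (I : Ideal A) : ∃ m, I ^ m • ⊤ ⊓ zeroColonPowers I M = ⊥ := by
  obtain ⟨k, hk⟩ := exists_pow_smul_zeroColonPowers_eq_bot (M := M) I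
  obtain ⟨l, hl⟩ := I.exists_pow_inf_eq_pow_smul (zeroColonPowers I M)
  refine ⟨l + k, ?_⟩
  rw [hl _ (Nat.le_add_right l k), Nat.add_sub_cancel_left, eq_bot_iff, ← hk]
  exact Submodule.smul_mono le_rfl inf_le_right

/-- Modular law: (B'M + T) ∩ BM = B'M + (T ∩ BM) = B'M. -/
theorem relLength_smul_top_quotient {T : Submodule A M} {B B' : Ideal A} (hB : B' ≤ B)
    (hT : B • (⊤ : Submodule A M) ⊓ T = ⊥) :
    relLength (B • (⊤ : Submodule A (M ⧸ T))) (B' • ⊤) =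
      relLength (B • (⊤ : Submodule A M)) (B' • ⊤) := by
  have h : ∀ B : Ideal A, B • (⊤ : Submodule A (M ⧸ T)) =
      (B • (⊤ : Submodule A M)).map T.mkQ := fun B => by
    rw [Submodule.map_smul'', Submodule.map_top, Submodule.range_mkQ]
  rw [h, h, relLength_map, Submodule.comap_map_mkQ, ← relLength_inf, inf_comm, sup_comm,
    sup_inf_assoc_of_le T (Submodule.smul_mono_left hB), inf_comm T, hT, sup_bot_eq]

end ZeroColonPowers

/-! ### Good filtrations and the main theorem -/

namespace IdealFiltration

variable {A : Type*} [CommRing A]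

theorem ideal_antitone (F : IdealFiltration A) : Antitone F.ideal :=
  antitone_nat_of_succ_le F.ideal_succ_le

theorem ideal_one_pow_le (F : IdealFiltration A) (n : ℕ) : F.ideal 1 ^ n ≤ F.ideal n := by
  induction n with
  | zero => simp [F.ideal_zero]
  | succ n ih =>
    rw [pow_succ]
    exact (Ideal.mul_mono_left ih).trans (F.mul_le n 1)

theorem IsGoodFor.le_ideal_one {F : IdealFiltration A} {J : Ideal A} (h : F.IsGoodFor J) :
    J ≤ F.ideal 1 := by
  have := h.1 0
  rwa [F.ideal_zero, Ideal.mul_top] at this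

theorem IsGoodFor.exists_ideal_add {F : IdealFiltration A} {J : Ideal A} (h : F.IsGoodFor J) :
    ∃ N, ∀ n a, N ≤ n → F.ideal (n + a) = J ^ a * F.ideal n := by
  obtain ⟨N, hN⟩ := h.2
  refine ⟨N, fun n a hn => ?_⟩
  induction a with
  | zero => simp
  | succ a ih => rw [← add_assoc, hN _ (by omega), ih, pow_succ', mul_assoc]

/-- A power of the maximal ideal lies in F₁, hence a higher one in F_{N+1} = J F_N ⊆ J. -/
theorem IsGoodFor.exists_maximalIdeal_pow_le [IsLocalRing A] [IsNoetherianRing A]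
    {F : IdealFiltration A} {J : Ideal A} (h : F.IsGoodFor J) (hF : F.IsMaximalPrimary) :
    ∃ r, IsLocalRing.maximalIdeal A ^ r ≤ J := by
  obtain ⟨e, he⟩ := (F.ideal 1).exists_radical_pow_le_of_fg (IsNoetherian.noetherian _)
  rw [hF.2] at he
  obtain ⟨N, hN⟩ := h.2
  refine ⟨e * (N + 1), ?_⟩
  rw [pow_mul]
  refine (Ideal.pow_right_mono he _).trans ((F.ideal_one_pow_le _).trans ?_)
  rw [hN N le_rfl]
  exact Ideal.mul_le_left

theorem ideal_one_le_maximalIdeal [IsLocalRing A] (F : IdealFiltration A) :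
    F.ideal 1 ≤ IsLocalRing.maximalIdeal A :=
  IsLocalRing.le_maximalIdeal (F.ideal_zero ▸ F.ideal_one_lt).ne

end IdealFiltration

theorem filtrationProduct_eq_idealProduct {A : Type*} [CommRing A] (M : Type*) [AddCommGroup M]
    [Module A M] {s : ℕ} (F : IdealFiltration A) (G : Fin s → IdealFiltration A) (n₀ : ℕ)
    (n : Fin s → ℕ) : filtrationProduct M F G n₀ n =
      idealProduct M (fun i => (Fin.cons F G : Fin (s + 1) → IdealFiltration A) i |>.ideal)
        (Fin.cons n₀ n) := by
  rw [filtrationProduct, idealProduct, Fin.prod_univ_succ]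
  simp

theorem proposition2p2 {A : Type*} [CommRing A] [IsLocalRing A] [IsNoetherianRing A]
    {M : Type*} [AddCommGroup M] [Module A M] [Module.Finite A M]
    {s : ℕ} (hs : 0 < s)
    (F : IdealFiltration A) (hF : F.IsGood) (hFm : F.IsMaximalPrimary)
    (G : Fin s → IdealFiltration A) (hG : ∀ i, (G i).IsGood)
    (I : Ideal A) (hI : I = ∏ i, (G i).ideal 1)
    (hIM : ¬ I ≤ (Module.annihilator A M).radical) :
    ∃ P : MvPolynomial (Fin (s + 1)) ℚ,
      P ≠ 0 ∧
      Module.supportDim A (M ⧸ zeroColonPowers I M) = (P.totalDegree : WithBot ℕ∞) + 1 ∧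
      ∃ N : ℕ, ∀ (n₀ : ℕ) (n : Fin s → ℕ), N ≤ n₀ → (∀ i, N ≤ n i) →
        bhattacharya M F G n₀ n ≠ ⊤ ∧
        ((bhattacharya M F G n₀ n).toNat : ℚ) =
          MvPolynomial.eval (Fin.cons (n₀ : ℚ) (fun i => (n i : ℚ))) P := by
  obtain ⟨J₀, hJ₀⟩ := hF
  choose J hJ using hG
  obtain ⟨r, hr⟩ := hJ₀.exists_maximalIdeal_pow_le hFm
  obtain ⟨N₀, hN₀⟩ := hJ₀.exists_ideal_add
  choose N₁ hN₁ using fun i => (hJ i).exists_ideal_add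
  obtain ⟨m, hm⟩ := exists_pow_smul_top_inf_zeroColonPowers_eq_bot (M := M) I
  let N := N₀ + ∑ i, N₁ i
  have hN₁N : ∀ i, N₁ i ≤ N := fun i =>
    (Finset.single_le_sum (f := N₁) (fun _ _ => Nat.zero_le _) (Finset.mem_univ i)).trans
      (Nat.le_add_left _ _)
  let H : Fin (s + 1) → ℕ → Ideal A := fun i =>
    (Fin.cons F G : Fin (s + 1) → IdealFiltration A) i |>.ideal
  have hH : ∀ i n a, N ≤ n →
      H i (n + a) = (Fin.cons J₀ J : Fin (s + 1) → Ideal A) i ^ a * H i n := by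
    intro i n a hn
    refine Fin.cases ?_ (fun i => ?_) i
    · exact hN₀ n a ((Nat.le_add_right _ _).trans hn)
    · exact hN₁ i n a ((hN₁N i).trans hn)
  -- Here s ≥ 1 matters: an empty product would give I = A.
  have hIm : I ≤ IsLocalRing.maximalIdeal A := by
    rw [hI]
    exact (Ideal.prod_le_inf.trans (Finset.inf_le (Finset.mem_univ ⟨0, hs⟩))).trans
      (G _).ideal_one_le_maximalIdeal
  have hIpow : ∀ k, I ^ k = ∏ i, (G i).ideal 1 ^ k := fun k => by rw [hI, Finset.prod_pow]
  obtain ⟨e, he⟩ := (F.ideal 1).exists_radical_pow_le_of_fg (IsNoetherian.noetherian _)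
  rw [hFm.2] at he
  have htf : ∀ (n : Fin (s + 1) → ℕ) (x : M ⧸ zeroColonPowers I M),
      (∀ a ∈ ∏ i, H i (n i), a • x = 0) → x = 0 := by
    intro n x hx
    -- The part e · n 0 of the exponent goes into F, because I^e ⊆ 𝔪^e ⊆ F₁; the remaining part goes
    -- into every G i at once.
    refine eq_zero_of_pow_smul_eq_zero (k := e * n 0 + ∑ i : Fin s, n i.succ) fun a ha =>
      hx a ?_
    rw [Fin.prod_univ_succ]
    rw [pow_add] at ha
    refine Ideal.mul_mono ?_ ?_ ha
    · rw [pow_mul]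
      exact (Ideal.pow_right_mono ((Ideal.pow_right_mono hIm e).trans he) _).trans
        (F.ideal_one_pow_le _)
    · rw [hIpow]
      refine Finset.prod_le_prod' fun i _ => ?_
      refine (Ideal.pow_le_pow_right ?_).trans ((G i).ideal_one_pow_le _)
      exact Finset.single_le_sum (f := fun i : Fin s => n i.succ) (fun _ _ => Nat.zero_le _)
        (Finset.mem_univ i)
  have hnontrivial : Nontrivial (M ⧸ zeroColonPowers I M) :=
    Submodule.Quotient.nontrivial_iff.2 (zeroColonPowers_ne_top hIM)
  obtain ⟨P, hP0, hdim, N', hP⟩ := exists_mvPolynomial_idealProduct hH (o := 0) hr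
    (hJ₀.le_ideal_one.trans F.ideal_one_le_maximalIdeal) htf
  -- N' makes P valid, N makes the recursions hold, and m places the product module inside I^m M,
  -- away from the torsion.
  refine ⟨P, hP0, hdim, N' + N + m, fun n₀ n hn₀ hn => ?_⟩
  have hB : ∏ i, (G i).ideal (n i) ≤ I ^ m := by
    rw [hIpow]
    refine Finset.prod_le_prod' fun i _ => ?_
    have h1 : N + m ≤ n i := by
      have := hn i
      omega
    refine ((G i).ideal_antitone h1).trans ?_
    rw [hN₁ i _ _ (hN₁N i)]
    exact Ideal.mul_le_left.trans (Ideal.pow_right_mono (hJ i).le_ideal_one m)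
  have hsucc : F.ideal (n₀ + 1) * ∏ i, (G i).ideal (n i) ≤
      F.ideal n₀ * ∏ i, (G i).ideal (n i) := Ideal.mul_mono_left (F.ideal_succ_le n₀)
  have hbot : (F.ideal n₀ * ∏ i, (G i).ideal (n i)) • (⊤ : Submodule A M) ⊓
      zeroColonPowers I M = ⊥ := by
    rw [eq_bot_iff, ← hm]
    exact inf_le_inf_right _ (Submodule.smul_mono_left (Ideal.mul_le_right.trans hB))
  have hbhatt : bhattacharya M F G n₀ n =
      relLength (idealProduct (M ⧸ zeroColonPowers I M) H (Fin.cons n₀ n))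
        (J₀ • idealProduct (M ⧸ zeroColonPowers I M) H (Fin.cons n₀ n)) := by
    rw [← filtrationProduct_eq_idealProduct, filtrationProduct, ← Submodule.mul_smul,
      ← mul_assoc]
    have h1 : J₀ * F.ideal n₀ = F.ideal (n₀ + 1) := by
      rw [hN₀ n₀ 1 (by omega), pow_one]
    rw [h1, relLength_smul_top_quotient hsucc hbot]
    rfl
  have hcast : (fun i => (((Fin.cons n₀ n : Fin (s + 1) → ℕ) i : ℕ) : ℚ)) =
      Fin.cons (n₀ : ℚ) (fun i => (n i : ℚ)) := by
    funext i
    refine Fin.cases ?_ (fun i => ?_) i <;> simp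
  have h := hP (Fin.cons n₀ n) fun i => by
    refine Fin.cases ?_ (fun i => ?_) i
    · rw [Fin.cons_zero]
      omega
    · rw [Fin.cons_succ]
      have := hn i
      omega
  rw [hcast] at h
  rw [hbhatt]
  exact h
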